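/- Fix an integer $m\ge 1$, real constants $s,l\in(0,1]$, and integers $T\ge 9$, $k\ge 1$. \textbf{Model.} Let $G=G_n^m$ be the preferential attachment multigraph on $n$ nodes: nodes arrive one at a time, and each arriving node $u$ inserts $m$ edges one after the other; if $M$ denotes the sum of all degrees just before an edge of $u$ is inserted, the second endpoint of this edge is a node $x\ne u$ already present with probability $\deg(x)/(M+1)$ and is $u$ itself with probability $(\deg(u)+1)/(M+1)$ (so the first node carries $m$ self-loops; degrees are counted with multiplicity, a self-loop counting twice). Let $d(v)$ be the degree of $v$ in $G$. Given $G$, the copies $G_1,G_2$ keep each edge of $G$ independently with probability $s$, and the initial link set $L$ contains each pair $(v,v)$ (the node $v$ of $G_1$ and its copy $v$ in $G_2$) independently with probability $l$; all these choices are independent. For a link set $L'$, the similarity witnesses of a pair $(u,v)$, $u\in G_1$, $v\in G_2$, are the pairs $(a,b)\in L'$ with $a$ a neighbour of $u$ in $G_1$ and $b$ a neighbour of $v$ in $G_2$; first-phase witnesses are those with respect to the initial set $L$. \textbf{Algorithm.} User-Matching with minimum score $T$ and $k$ iterations: repeat $k$ times, for $j=\lfloor\log_2 D\rfloor,\dots,1$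 ($D$ the maximum degree in the copies), compute the number of similarity witnesses, with respect to the current link set, of every pair $(u,v)$ with $d_{G_1}(u)\ge 2^j$ and $d_{G_2}(v)\ge 2^j$; then add every such pair whose score is at least $T$ and is strictly higher than the score of every other such pair that contains $u$ (as node of $G_1$) or $v$ (as node of $G_2$). \textbf{Claim.} With probability tending to $1$ as $n\to\infty$, the following holds simultaneously for every node $v$ with $d(v)\ge 4\log^2 n/(s^2 l)$ (natural logarithm): (1) $v$ has at least $\frac78 d(v)s^2l$ first-phase similarity witnesses with its true copy, i.e. for the pair $(v,v)$; (2) for every node $u\ne v$, each of the pairs $(v,u)$ and $(u,v)$ has fewer than $\frac78 d(v)s^2l$ first-phase similarity witnesses; (3) $v$ is identified correctly: the output of User-Matching contains $(v,v)$ and contains no pair $(v,u)$ or $(u,v)$ with $u\ne v$. -/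

import Mathlib

open Filter Topology MeasureTheory ProbabilityTheory

namespace Recon

/-! ### Multigraphs -/

/-- A finite multigraph on vertices in `ℕ`: the multiset of its edges. The edge `(a, b)` joins
`a` and `b` (the order carries no meaning) and is a self-loop if `a = b`. -/
abbrev Multigraph := Multiset (ℕ × ℕ)

/-- The multiset of all endpoints of edges, two for each edge. -/
def endpoints (G : Multigraph) : Multiset ℕ := G.map Prod.fst + G.map Prod.snd

/-- The degree of `v`, counted with multiplicity; a self-loop at `v` contributes two. -/
def degree (G : Multigraph) (v : ℕ) : ℕ := (endpoints G).count v

/-- `a` is a neighbour of `b`. -/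
def Adj (G : Multigraph) (a b : ℕ) : Prop := (a, b) ∈ G ∨ (b, a) ∈ G

instance (G : Multigraph) (a b : ℕ) : Decidable (Adj G a b) :=
  inferInstanceAs (Decidable ((a, b) ∈ G ∨ (b, a) ∈ G))

/-! ### Preferential attachment -/

/-- The law of the second endpoint of the next edge of the current node `u`: it is uniform on the
multiset formed by all endpoints of the present edges and one further copy of `u`. See
`attach_apply` for the probabilities. -/
noncomputable def attach (G : Multigraph) (u : ℕ) : PMF ℕ :=
  PMF.ofMultiset (u ::ₘ endpoints G) (Multiset.cons_ne_zero)

/-- The sum `M` of all degrees is twice the number of edges. -/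
theorem card_endpoints (G : Multigraph) : (endpoints G).card = 2 * G.card := by
  simp [endpoints, two_mul]

/-- A node `x ≠ u` is chosen with probability `deg x / (M + 1)`, and `u` itself with probability
`(deg u + 1) / (M + 1)`, where `M` is the sum of all degrees. -/
theorem attach_apply (G : Multigraph) (u x : ℕ) :
    attach G u x = ((degree G x + if x = u then 1 else 0 : ℕ) : ENNReal) /
      ((2 * G.card + 1 : ℕ) : ENNReal) := by
  rw [attach, PMF.ofMultiset_apply, Multiset.card_cons, card_endpoints, degree,
    ← Multiset.count_cons]
  congr!

/-- The multigraph in which each node `u` (the nodes arrive in the order `0, 1, 2, …`) sends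
`m` edges, the edges being inserted one after the other: edge number `e` has source `e / m` and
second endpoint `f e`. -/
def graphOf (m : ℕ) {k : ℕ} (f : Fin k → ℕ) : Multigraph :=
  (Finset.univ : Finset (Fin k)).val.map fun e : Fin k => ((e : ℕ) / m, f e)

/-- The law of the second endpoints of the first `k` edges of the preferential attachment
process. -/
noncomputable def paTargets (m : ℕ) : (k : ℕ) → PMF (Fin k → ℕ)
  | 0 => PMF.pure Fin.elim0
  | k + 1 => (paTargets m k).bind fun f =>
      (attach (graphOf m f) (k / m)).map fun x => Fin.snoc (α := fun _ => ℕ) f x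

/-! ### The two copies and the seed links -/

/-- An outcome: the second endpoints of the `n * m` edges of the underlying graph, the sets of
edges which survive in the first and in the second copy, and the set of nodes that are
initially linked. -/
abbrev Outcome (m n : ℕ) : Type :=
  (Fin (n * m) → ℕ) × (Fin (n * m) → Bool) × (Fin (n * m) → Bool) × (Fin n → Bool)

/-- The law of the model: the underlying graph is the preferential attachment graph with `n` nodes
and parameter `m`; each edge survives in each copy with probability `s`, and each node is linked
with probability `l`, all these choices being independent. -/
noncomputable def law (m n : ℕ) (s l : unitInterval) : Measure (Outcome m n) :=
  (paTargets m (n * m)).toMeasure.prod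
    ((Measure.pi fun _ => bernoulliMeasure true false s).prod
      ((Measure.pi fun _ => bernoulliMeasure true false s).prod
        (Measure.pi fun _ => bernoulliMeasure true false l)))

/-- The sub-multigraph of `graphOf m f` formed by the edges that survive according to `b`. -/
def survivors (m : ℕ) {k : ℕ} (f : Fin k → ℕ) (b : Fin k → Bool) : Multigraph :=
  ((Finset.univ : Finset (Fin k)).filter fun e : Fin k => b e = true).val.map
    fun e : Fin k => ((e : ℕ) / m, f e)

/-- The underlying graph. -/
def graph {m n : ℕ} (ω : Outcome m n) : Multigraph := graphOf m ω.1

/-- The first copy. -/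
def copy₁ {m n : ℕ} (ω : Outcome m n) : Multigraph := survivors m ω.1 ω.2.1

/-- The second copy. -/
def copy₂ {m n : ℕ} (ω : Outcome m n) : Multigraph := survivors m ω.1 ω.2.2.1

/-- The initial identification links. A link `(a, b)` identifies the node `a` of the first copy
with the node `b` of the second. -/
def seeds {m n : ℕ} (ω : Outcome m n) : Finset (ℕ × ℕ) :=
  ((Finset.univ : Finset (Fin n)).filter fun v : Fin n => ω.2.2.2 v = true).image
    fun v : Fin n => ((v : ℕ), (v : ℕ))

/-! ### Similarity witnesses and the algorithm User-Matching -/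

/-- The number of similarity witnesses for the pair consisting of the node `u` of `G₁` and the node
`v` of `G₂`, with respect to the set `L` of links. -/
def score (G₁ G₂ : Multigraph) (L : Finset (ℕ × ℕ)) (u v : ℕ) : ℕ :=
  (L.filter fun p => Adj G₁ p.1 u ∧ Adj G₂ p.2 v).card

/-- The pairs of nodes whose degrees in the respective graphs are at least `2 ^ j`. -/
def eligible (n : ℕ) (G₁ G₂ : Multigraph) (j : ℕ) : Finset (ℕ × ℕ) :=
  (Finset.range n ×ˢ Finset.range n).filter fun p =>
    2 ^ j ≤ degree G₁ p.1 ∧ 2 ^ j ≤ degree G₂ p.2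

/-- One phase: every eligible pair whose score is at least `T` and is higher than that of every
other eligible pair which shares a node with it is added to the links. -/
def phase (n : ℕ) (G₁ G₂ : Multigraph) (T j : ℕ) (L : Finset (ℕ × ℕ)) : Finset (ℕ × ℕ) :=
  L ∪ (eligible n G₁ G₂ j).filter fun p =>
    T ≤ score G₁ G₂ L p.1 p.2 ∧
      ∀ q ∈ eligible n G₁ G₂ j, q ≠ p → (q.1 = p.1 ∨ q.2 = p.2) →
        score G₁ G₂ L q.1 q.2 < score G₁ G₂ L p.1 p.2

/-- The phases `j, j - 1, …, 1`, in this order. -/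
def sweep (n : ℕ) (G₁ G₂ : Multigraph) (T : ℕ) : ℕ → Finset (ℕ × ℕ) → Finset (ℕ × ℕ)
  | 0, L => L
  | j + 1, L => sweep n G₁ G₂ T j (phase n G₁ G₂ T (j + 1) L)

/-- The maximum degree of a node in the two graphs. -/
def maxDegree (n : ℕ) (G₁ G₂ : Multigraph) : ℕ :=
  (Finset.range n).sup fun v => max (degree G₁ v) (degree G₂ v)

/-- The output of User-Matching on two graphs on the nodes `0, …, n - 1` with initial links `L`,
minimum matching score `T` and `k` iterations. -/
def userMatching (n : ℕ) (G₁ G₂ : Multigraph) (L : Finset (ℕ × ℕ)) (T k : ℕ) :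
    Finset (ℕ × ℕ) :=
  (sweep n G₁ G₂ T (Nat.log 2 (maxDegree n G₁ G₂)))^[k] L

end Recon

namespace Recon

open Finset

/-! ### Expectations under the attachment process -/

/-! Two different nodes of a preferential attachment graph have very few common neighbours unless
both are among the oldest nodes, and the oldest nodes have degrees far above any number of common
neighbours. So true pairs beat wrong ones, and with high probability User-Matching never adds a
wrong link at all.

The engine is `ev_present_le`: r prescribed edges, number ε into node τ, are all present with
probability at most C_r ∏ √2 / √((ε + 1)(τ + 1)). Edges are positively correlated, because each hit
raises a degree; a potential built from rising factorials of degrees absorbs this, and `stepFactor`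
controls its growth at each insertion. Summing over r-tuples of nodes gives
`ev_descFactorial_shared_le`. For r = 4 the factorial moment of the number of nodes shared by u and
v is O(log⁴ n / ((u + 1)² (v + 1)²)), which is summable over pairs. Put x = n^(1/40) and U = ⌈x²⌉.
With high probability pairs not both below U share at most 3 nodes, and all other pairs at most x⁸ +
3. The case u = v counts multiple edges at v, so nearly all of a large degree comes from distinct
senders. For distinct senders the events "the edge survives twice and the sender is a seed" are
independent, and a Chernoff bound (`samples_score_lt_le`) yields the first-phase witnesses.

For the early nodes, those below U, `ev_degree_eq_le` shows that no value of a degree is likely.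
Hence their degrees exceed x¹². The same anticoncentration settles a subtle point of the algorithm:
a wrong pair (u, v) is blocked by (v, v) only if (v, v) is eligible in the same phase. Chebyshev's
inequality puts both copies' degrees of an early v within x¹⁶ of s·d(v), and anticoncentration keeps
s·d(v) at distance at least x¹⁶ from every power of two, so both degrees pass the same thresholds.

On the event `Good` the rest is deterministic (`Good.conclusion`): a wrong pair involving a late
node has at most 5 < T witnesses, and a wrong pair of early nodes always loses to the true pair. -/

theorem tsum_bind_mul {α β : Type*} (p : PMF α) (q : α → PMF β) (F : β → ENNReal) :
    ∑' b, (p.bind q) b * F b = ∑' a, p a * ∑' b, q a b * F b := by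
  simp only [PMF.bind_apply, ← ENNReal.tsum_mul_right, ← ENNReal.tsum_mul_left]
  rw [ENNReal.tsum_comm]
  simp only [mul_assoc]

theorem tsum_map_mul {α β : Type*} (p : PMF α) (g : α → β) (F : β → ENNReal) :
    ∑' b, (p.map g) b * F b = ∑' a, p a * F (g a) := by
  rw [PMF.map, tsum_bind_mul]
  refine tsum_congr fun a => ?_
  congr 1
  rw [tsum_eq_single (g a)]
  · simp
  · intro b hb
    simp [hb]

/-- The expectation of `F` under the law of the first `k` targets. -/
noncomputable def ev (m k : ℕ) (F : (Fin k → ℕ) → ENNReal) : ENNReal :=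
  ∑' f, paTargets m k f * F f

theorem ev_succ (m k : ℕ) (F : (Fin (k + 1) → ℕ) → ENNReal) :
    ev m (k + 1) F = ev m k fun f =>
      ∑' x, attach (graphOf m f) (k / m) x * F (Fin.snoc (α := fun _ => ℕ) f x) := by
  rw [ev, paTargets, tsum_bind_mul]
  simp only [tsum_map_mul]
  rfl

theorem ev_mono {m k : ℕ} {F G : (Fin k → ℕ) → ENNReal}
    (h : ∀ f, paTargets m k f ≠ 0 → F f ≤ G f) : ev m k F ≤ ev m k G := by
  refine ENNReal.tsum_le_tsum fun f => ?_
  by_cases hf : paTargets m k f = 0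
  · simp [hf]
  · exact mul_le_mul_right (h f hf) _

theorem ev_const_mul (m k : ℕ) (c : ENNReal) (F : (Fin k → ℕ) → ENNReal) :
    ev m k (fun f => c * F f) = c * ev m k F := by
  simp only [ev, ← ENNReal.tsum_mul_left]
  exact tsum_congr fun f => by ring

theorem ev_const (m k : ℕ) (c : ENNReal) : ev m k (fun _ => c) = c := by
  simp [ev, ENNReal.tsum_mul_right, PMF.tsum_coe]

theorem ev_zero (m : ℕ) (F : (Fin 0 → ℕ) → ENNReal) : ev m 0 F = F Fin.elim0 := by
  rw [ev, tsum_eq_single Fin.elim0]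
  · simp [paTargets]
  · intro f hf
    exact absurd (Subsingleton.elim _ _) hf

theorem ev_finset_sum {ι : Type*} (m k : ℕ) (S : Finset ι) (F : ι → (Fin k → ℕ) → ENNReal) :
    ev m k (fun f => ∑ i ∈ S, F i f) = ∑ i ∈ S, ev m k (F i) := by
  simp only [ev, Finset.mul_sum]
  rw [Summable.tsum_finsetSum]
  exact fun _ _ => ENNReal.summable

/-! ### Degrees in the attachment process -/

/-- The number of edges whose second endpoint is `x`. -/
def hits {k : ℕ} (f : Fin k → ℕ) (x : ℕ) : ℕ := ∑ e, if f e = x then 1 else 0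

/-- The number of edges, among the first `k`, whose source is `x`. -/
def outs (m k x : ℕ) : ℕ := ∑ e : Fin k, if (e : ℕ) / m = x then 1 else 0

theorem hits_snoc {k : ℕ} (f : Fin k → ℕ) (x y : ℕ) :
    hits (Fin.snoc (α := fun _ => ℕ) f y) x = hits f x + if y = x then 1 else 0 := by
  simp only [hits, Fin.sum_univ_castSucc, Fin.snoc_castSucc, Fin.snoc_last]

theorem outs_succ (m k x : ℕ) : outs m (k + 1) x = outs m k x + if k / m = x then 1 else 0 := by
  simp only [outs, Fin.sum_univ_castSucc, Fin.val_castSucc, Fin.val_last]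

theorem outs_eq {m : ℕ} (hm : 1 ≤ m) (k x : ℕ) : outs m k x = min (k - m * x) m := by
  induction k with
  | zero => simp [outs]
  | succ k ih =>
    rw [outs_succ, ih]
    have h : k / m = x ↔ m * x ≤ k ∧ k < m * x + m := by
      rw [Nat.div_eq_iff (by omega)]
      rw [mul_comm x m]
      omega
    simp only [h]
    split_ifs <;> omega

theorem degree_graphOf {k : ℕ} (m : ℕ) (f : Fin k → ℕ) (x : ℕ) :
    degree (graphOf m f) x = outs m k x + hits f x := by
  simp only [degree, endpoints, graphOf, Multiset.map_map, Multiset.count_add, hits, outs,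
    Multiset.count_map, Function.comp_def]
  congr 1
  · rw [← Finset.card_filter]
    simp only [Finset.card, Finset.filter, eq_comm]
  · rw [← Finset.card_filter]
    simp only [Finset.card, Finset.filter, eq_comm]

theorem card_graphOf {k : ℕ} (m : ℕ) (f : Fin k → ℕ) : (graphOf m f).card = k := by
  simp [graphOf]

theorem le_source_of_paTargets_ne_zero {m k : ℕ} :
    ∀ f, paTargets m k f ≠ 0 → ∀ e : Fin k, f e ≤ e / m := by
  induction k with
  | zero => exact fun f _ e => e.elim0
  | succ k ih =>
    intro f hf
    rw [← PMF.mem_support_iff, paTargets, PMF.mem_support_bind_iff] at hf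
    obtain ⟨g, hg, hf⟩ := hf
    rw [PMF.mem_support_map_iff] at hf
    obtain ⟨x, hx, rfl⟩ := hf
    have hg' := ih g hg
    intro e
    refine Fin.lastCases ?_ (fun e => ?_) e
    · simp only [Fin.snoc_last, Fin.val_last]
      rw [PMF.mem_support_iff, attach_apply, degree_graphOf] at hx
      by_contra hlt
      push Not at hlt
      apply hx
      have h1 : outs m k x = 0 := by
        refine Finset.sum_eq_zero fun e _ => ?_
        rw [if_neg]
        have := Nat.div_le_div_right (c := m) e.2.le
        omega
      have h2 : hits g x = 0 := by
        refine Finset.sum_eq_zero fun e _ => ?_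
        rw [if_neg]
        have := Nat.div_le_div_right (c := m) e.2.le
        have := hg' e
        omega
      rw [h1, h2, if_neg (by omega)]
      simp
    · simpa using hg' e

theorem hits_eq_zero {m k : ℕ} {f : Fin k → ℕ} (hf : paTargets m k f ≠ 0) {x : ℕ}
    (hx : k < m * x) : hits f x = 0 := by
  refine Finset.sum_eq_zero fun e _ => ?_
  rw [if_neg]
  rintro rfl
  have h := le_source_of_paTargets_ne_zero f hf e
  have := Nat.div_mul_le_self e m
  have := Nat.mul_le_mul_left m h
  have := e.2
  lia

/-- One numerator serves both cases. For the current node the extra 1 is the source end of the edge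
being inserted, and with it the node still has at most `m` outgoing ends. Nodes that have not
arrived get probability 0. -/
theorem attach_le {m k : ℕ} (hm : 1 ≤ m) {f : Fin k → ℕ} (hf : paTargets m k f ≠ 0) (x : ℕ) :
    attach (graphOf m f) (k / m) x ≤
      if m * x ≤ k then ((m + hits f x : ℕ) : ENNReal) / ((2 * k + 1 : ℕ) : ENNReal) else 0 := by
  rw [attach_apply, degree_graphOf, card_graphOf]
  split_ifs with h1 h2 h2
  · refine ENNReal.div_le_div_right ?_ _
    have := outs_eq hm (k + 1) x
    rw [outs_succ, if_pos h1.symm] at this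
    norm_cast
    omega
  · exfalso
    subst h1
    exact h2 (Nat.mul_div_le k m)
  · refine ENNReal.div_le_div_right ?_ _
    have := outs_eq hm k x
    norm_cast
    omega
  · rw [hits_eq_zero hf (by omega), outs_eq hm, show k - m * x = 0 by omega]
    simp

/-! ### The probability of prescribed edges -/

/-- A hit on a node of weight `D` with `R` pending edges multiplies the potential by `1 + R / D`.
The hit has probability at most `D / M`, so `D` cancels and the mean gain depends on `R` alone. -/
theorem mul_le_of_mul_eq {a A A' D R M : ENNReal} (hD : D ≠ 0) (hD' : D ≠ ⊤)
    (h : A' * D = A * (D + R)) (ha : a ≤ D / M) : a * A' ≤ a * A + A * (R / M) := by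
  have h1 : A' = A + A * R / D := by
    rw [ENNReal.eq_div_iff hD hD' |>.2 (by rw [mul_comm, h] : D * A' = A * (D + R)), mul_add,
      ENNReal.add_div, mul_div_assoc, ENNReal.div_self hD hD', mul_one]
  rw [h1, mul_add]
  refine add_le_add_right ?_ _
  calc a * (A * R / D) ≤ D / M * (A * R / D) := by gcongr
    _ = A * (R / M) * (D * D⁻¹) := by simp only [div_eq_mul_inv]; ring
    _ = A * (R / M) := by rw [ENNReal.mul_inv_cancel hD hD', mul_one]

/-- Turns the total gain of one insertion into separate factors, one for each prescribed edge. -/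
theorem one_add_sum_le_prod {ι : Type*} (S : Finset ι) (w : ι → ENNReal) :
    1 + ∑ i ∈ S, w i ≤ ∏ i ∈ S, (1 + w i) := by
  classical
  induction S using Finset.induction_on with
  | empty => simp
  | insert a S ha ih =>
    rw [Finset.sum_insert ha, Finset.prod_insert ha]
    calc 1 + (w a + ∑ i ∈ S, w i) ≤ (1 + ∑ i ∈ S, w i) + w a * (1 + ∑ i ∈ S, w i) := by
          rw [mul_add, mul_one, ← add_assoc, ← add_assoc, add_right_comm]
          exact le_self_add
      _ = (1 + w a) * (1 + ∑ i ∈ S, w i) := by ring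
      _ ≤ _ := by gcongr

section Prescribed

variable {ι : Type*} [Fintype ι]

/-- The number of prescribed edges with target `x` which are still to come at time `k`. -/
def pending (ε τ : ι → ℕ) (k x : ℕ) : ℕ := ∑ i, if k ≤ ε i ∧ τ i = x then 1 else 0

/-- The potential: a product of rising factorials of (slightly increased) degrees. -/
def potential (m : ℕ) (ε τ : ι → ℕ) {k : ℕ} (f : Fin k → ℕ) : ℕ :=
  ∏ x ∈ univ.image τ, (m + hits f x).ascFactorial (pending ε τ k x)

open Classical in
/-- The indicator of the event that the prescribed edges among the first `k` are present. -/
noncomputable def present (ε τ : ι → ℕ) {k : ℕ} (f : Fin k → ℕ) : ENNReal :=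
  if ∀ i, ∀ h : ε i < k, f ⟨ε i, h⟩ = τ i then 1 else 0

/-- The factor contributed by the edge number `t` to the bound on the probability. -/
noncomputable def stepFactor (m : ℕ) (ε τ : ι → ℕ) (t : ℕ) : ENNReal :=
  ∏ i, (if ε i = t then ((2 * t + 1 : ℕ) : ENNReal)⁻¹
    else if m * τ i ≤ t ∧ t < ε i then 1 + ((2 * t + 1 : ℕ) : ENNReal)⁻¹ else 1)

/-- Writing a⁽ᴿ⁾ for the rising factorial, D · (D + 1)⁽ᴿ⁾ = D⁽ᴿ⁾ · (D + R). The identity is kept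
cross-multiplied to stay in `ℕ`. -/
theorem potential_snoc_of_pending_eq {m : ℕ} {ε τ : ι → ℕ} {k : ℕ}
    (hk : ∀ i, ε i ≠ k) (f : Fin k → ℕ) (y : ℕ) :
    potential m ε τ (Fin.snoc (α := fun _ => ℕ) f y) *
      (if y ∈ univ.image τ then m + hits f y else 1) =
    potential m ε τ f * (if y ∈ univ.image τ then m + hits f y + pending ε τ k y else 1) := by
  have hp : ∀ x, pending ε τ (k + 1) x = pending ε τ k x := fun x => by
    refine Finset.sum_congr rfl fun i _ => ?_
    have := hk i
    have h : k + 1 ≤ ε i ↔ k ≤ ε i := by omega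
    simp [h]
  simp only [potential, hits_snoc, hp]
  split_ifs with hy
  · rw [← Finset.mul_prod_erase _ _ hy, ← Finset.mul_prod_erase (univ.image τ) _ hy]
    have h1 : ∏ x ∈ (univ.image τ).erase y,
        (m + (hits f x + if y = x then 1 else 0)).ascFactorial (pending ε τ k x) =
        ∏ x ∈ (univ.image τ).erase y, (m + hits f x).ascFactorial (pending ε τ k x) := by
      refine Finset.prod_congr rfl fun x hx => ?_
      rw [if_neg (Finset.ne_of_mem_erase hx).symm, add_zero]
    rw [h1, if_pos rfl]
    have h2 := Nat.succ_ascFactorial (m + hits f y) (pending ε τ k y)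
    rw [Nat.succ_eq_add_one, add_assoc] at h2
    linear_combination (∏ x ∈ (univ.image τ).erase y,
      (m + hits f x).ascFactorial (pending ε τ k x)) * h2
  · rw [mul_one, mul_one]
    refine Finset.prod_congr rfl fun x hx => ?_
    rw [if_neg, add_zero]
    rintro rfl
    exact hy hx

/-- When a prescribed edge arrives, its target's weight D grows by one and its pending count R drops
by one, and D · (D + 1)⁽ᴿ⁻¹⁾ = D⁽ᴿ⁾. The lost factor D is exactly the numerator of the attachment
probability. -/
theorem potential_snoc_of_eq {m : ℕ} {ε τ : ι → ℕ} (hε : Function.Injective ε) (i : ι)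
    (f : Fin (ε i) → ℕ) :
    (m + hits f (τ i)) * potential m ε τ (Fin.snoc (α := fun _ => ℕ) f (τ i)) =
      potential m ε τ f := by
  classical
  have hp : ∀ x, pending ε τ (ε i) x = pending ε τ (ε i + 1) x + if τ i = x then 1 else 0 := by
    intro x
    simp only [pending]
    rw [← Finset.add_sum_erase _ _ (Finset.mem_univ i),
      ← Finset.add_sum_erase _ (fun j => if ε i + 1 ≤ ε j ∧ τ j = x then 1 else 0)
        (Finset.mem_univ i)]
    simp only [le_refl, true_and, Nat.not_succ_le_self, false_and, if_false, zero_add]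
    rw [add_comm]
    congr 1
    refine Finset.sum_congr rfl fun j hj => ?_
    have : ε j ≠ ε i := fun h => Finset.ne_of_mem_erase hj (hε h)
    have h : ε i + 1 ≤ ε j ↔ ε i ≤ ε j := by omega
    simp [h]
  have hy : τ i ∈ univ.image τ := Finset.mem_image_of_mem _ (Finset.mem_univ i)
  simp only [potential, hits_snoc, hp]
  rw [← Finset.mul_prod_erase _ _ hy, ← Finset.mul_prod_erase (univ.image τ) _ hy, ← mul_assoc]
  congr 1
  · simp only [if_true]
    have h2 := Nat.succ_ascFactorial (m + hits f (τ i)) (pending ε τ (ε i + 1) (τ i))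
    rw [Nat.succ_eq_add_one, add_assoc] at h2
    rw [h2, Nat.ascFactorial_succ]
  · refine Finset.prod_congr rfl fun x hx => ?_
    rw [if_neg (Finset.ne_of_mem_erase hx).symm, add_zero, add_zero]

theorem sum_pending (m : ℕ) (ε τ : ι → ℕ) (k : ℕ) :
    ∑ x ∈ univ.image τ, (if m * x ≤ k then pending ε τ k x else 0) =
      ∑ i, if m * τ i ≤ k ∧ k ≤ ε i then 1 else 0 := by
  have h : ∀ x, (if m * x ≤ k then pending ε τ k x else 0) =
      ∑ i, if m * τ i ≤ k ∧ k ≤ ε i ∧ τ i = x then 1 else 0 := by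
    intro x
    split_ifs with hx
    · refine Finset.sum_congr rfl fun i _ => ?_
      congr 1
      refine propext ⟨fun h => ⟨h.2 ▸ hx, h⟩, fun h => h.2⟩
    · refine (Finset.sum_eq_zero fun i _ => if_neg ?_).symm
      rintro ⟨h1, -, rfl⟩
      exact hx h1
  simp only [h]
  rw [Finset.sum_comm]
  refine Finset.sum_congr rfl fun i _ => ?_
  rw [Finset.sum_eq_single (τ i)]
  · simp
  · intro b _ hb
    rw [if_neg]
    rintro ⟨-, -, h⟩
    exact hb h.symm
  · intro h
    exact absurd (Finset.mem_image_of_mem _ (Finset.mem_univ i)) h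

theorem present_snoc_le {ε τ : ι → ℕ} {k : ℕ} (f : Fin k → ℕ) (y : ℕ) :
    present ε τ (Fin.snoc (α := fun _ => ℕ) f y) ≤ present ε τ f := by
  unfold present
  split_ifs with h1 h2 h2
  · rfl
  · refine absurd (fun i hi => ?_) h2
    have h := h1 i (Nat.lt_succ_of_lt hi)
    rwa [show (⟨ε i, Nat.lt_succ_of_lt hi⟩ : Fin (k + 1)) = Fin.castSucc ⟨ε i, hi⟩ from rfl,
      Fin.snoc_castSucc] at h
  · exact zero_le
  · rfl

theorem present_snoc_eq_zero {ε τ : ι → ℕ} (i : ι) (f : Fin (ε i) → ℕ) {y : ℕ} (hy : y ≠ τ i) :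
    present ε τ (Fin.snoc (α := fun _ => ℕ) f y) = 0 := by
  unfold present
  rw [if_neg]
  intro h
  have h := h i (Nat.lt_succ_self _)
  rw [show (⟨ε i, Nat.lt_succ_self _⟩ : Fin (ε i + 1)) = Fin.last _ from rfl, Fin.snoc_last] at h
  exact hy h

/-- Each pending edge whose target has already arrived contributes a relative gain of 1 / (2k + 1),
whatever the current degrees are. -/
theorem step_of_notMem {m : ℕ} (hm : 1 ≤ m) {ε τ : ι → ℕ} {k : ℕ} (hk : ∀ i, ε i ≠ k)
    {f : Fin k → ℕ} (hf : paTargets m k f ≠ 0) :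
    ∑' y, attach (graphOf m f) (k / m) y *
      (potential m ε τ (Fin.snoc (α := fun _ => ℕ) f y) : ENNReal) ≤
    stepFactor m ε τ k * potential m ε τ f := by
  set A : ENNReal := (potential m ε τ f : ENNReal)
  set M : ENNReal := ((2 * k + 1 : ℕ) : ENNReal)
  have key : ∀ y, attach (graphOf m f) (k / m) y *
      (potential m ε τ (Fin.snoc (α := fun _ => ℕ) f y) : ENNReal) ≤
      attach (graphOf m f) (k / m) y * A +
        if y ∈ univ.image τ then
          A * (((if m * y ≤ k then pending ε τ k y else 0 : ℕ) : ENNReal) / M) else 0 := by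
    intro y
    have h := potential_snoc_of_pending_eq (m := m) (τ := τ) hk f y
    have ha := attach_le hm hf y
    split_ifs at h ha ⊢ with h1 h2 h2
    · refine mul_le_of_mul_eq (D := ((m + hits f y : ℕ) : ENNReal)) ?_ ?_ ?_ ha
      · norm_cast; omega
      · simp
      · simp only [A]
        exact_mod_cast h
    · rw [le_zero_iff.1 ha]
      simp
    · rw [mul_one, mul_one] at h
      simp [h, A]
    · rw [le_zero_iff.1 ha]
      simp
  refine (ENNReal.tsum_le_tsum key).trans ?_
  rw [ENNReal.tsum_add, ENNReal.tsum_mul_right, PMF.tsum_coe, one_mul,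
    tsum_eq_sum (s := univ.image τ) (fun y hy => if_neg hy),
    Finset.sum_congr rfl (fun y hy => if_pos hy), ← Finset.mul_sum]
  have h1 : ∑ x ∈ univ.image τ, (((if m * x ≤ k then pending ε τ k x else 0 : ℕ) : ENNReal) / M) =
      ∑ i, if m * τ i ≤ k ∧ k < ε i then M⁻¹ else 0 := by
    simp only [div_eq_mul_inv]
    rw [← Finset.sum_mul, ← Nat.cast_sum, sum_pending, Nat.cast_sum, Finset.sum_mul]
    refine Finset.sum_congr rfl fun i _ => ?_
    have : k ≤ ε i ↔ k < ε i := by have := hk i; omega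
    simp only [this]
    split_ifs <;> simp
  rw [h1]
  calc A + A * ∑ i, (if m * τ i ≤ k ∧ k < ε i then M⁻¹ else 0)
      = (1 + ∑ i, (if m * τ i ≤ k ∧ k < ε i then M⁻¹ else 0)) * A := by ring
    _ ≤ stepFactor m ε τ k * A := by
        refine mul_le_mul_left ((one_add_sum_le_prod _ _).trans (le_of_eq ?_)) _
        unfold stepFactor
        refine Finset.prod_congr rfl fun i _ => ?_
        rw [if_neg (hk i)]
        split_ifs
        · rfl
        · simp

theorem step_of_eq {m : ℕ} (hm : 1 ≤ m) {ε τ : ι → ℕ} (hε : Function.Injective ε) (i : ι)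
    {f : Fin (ε i) → ℕ} (hf : paTargets m (ε i) f ≠ 0) :
    attach (graphOf m f) (ε i / m) (τ i) *
      (potential m ε τ (Fin.snoc (α := fun _ => ℕ) f (τ i)) : ENNReal) ≤
    stepFactor m ε τ (ε i) * potential m ε τ f := by
  have ha := attach_le hm hf (τ i)
  have h : (((2 * ε i + 1 : ℕ) : ENNReal))⁻¹ ≤ stepFactor m ε τ (ε i) := by
    unfold stepFactor
    classical
    rw [← Finset.mul_prod_erase _ _ (Finset.mem_univ i), if_pos rfl]
    refine le_mul_of_one_le_right (zero_le) (Finset.one_le_prod' fun j hj => ?_)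
    rw [if_neg fun h => Finset.ne_of_mem_erase hj (hε h)]
    split_ifs
    · exact le_self_add
    · rfl
  have ha' : attach (graphOf m f) (ε i / m) (τ i) ≤
      ((m + hits f (τ i) : ℕ) : ENNReal) / ((2 * ε i + 1 : ℕ) : ENNReal) := by
    refine ha.trans ?_
    split_ifs
    · rfl
    · exact zero_le
  rw [← potential_snoc_of_eq hε i f, Nat.cast_mul]
  calc _ ≤ ((m + hits f (τ i) : ℕ) : ENNReal) / ((2 * ε i + 1 : ℕ) : ENNReal) *
        (potential m ε τ (Fin.snoc (α := fun _ => ℕ) f (τ i)) : ENNReal) := by gcongr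
    _ = (((2 * ε i + 1 : ℕ) : ENNReal))⁻¹ * (((m + hits f (τ i) : ℕ) : ENNReal) *
        (potential m ε τ (Fin.snoc (α := fun _ => ℕ) f (τ i)) : ENNReal)) := by
          rw [div_eq_mul_inv]; ring
    _ ≤ _ := by gcongr

/-- Divided by the accumulated step factors, indicator times potential is a supermartingale. The
product of rising factorials on the right is its initial value, when nothing has been hit. -/
theorem ev_present_mul_potential_le {m : ℕ} (hm : 1 ≤ m) {ε τ : ι → ℕ}
    (hε : Function.Injective ε) (k : ℕ) :
    ev m k (fun f => present ε τ f * potential m ε τ f) ≤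
      (∏ x ∈ univ.image τ, (m.ascFactorial (pending ε τ 0 x) : ENNReal)) *
        ∏ t ∈ range k, stepFactor m ε τ t := by
  induction k with
  | zero =>
    rw [ev_zero]
    simp [present, potential, hits]
  | succ k ih =>
    rw [ev_succ, Finset.prod_range_succ, ← mul_assoc]
    refine le_trans ?_ (mul_le_mul_left ih _)
    rw [mul_comm, ← ev_const_mul]
    refine ev_mono fun f hf => ?_
    by_cases hk : ∀ i, ε i ≠ k
    · calc _ ≤ ∑' y, present ε τ f * (attach (graphOf m f) (k / m) y *
            (potential m ε τ (Fin.snoc (α := fun _ => ℕ) f y) : ENNReal)) := by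
            refine ENNReal.tsum_le_tsum fun y => ?_
            rw [mul_left_comm]
            exact mul_le_mul_left (present_snoc_le f y) _
        _ ≤ present ε τ f * (stepFactor m ε τ k * potential m ε τ f) := by
            rw [ENNReal.tsum_mul_left]
            exact mul_le_mul_right (step_of_notMem hm hk hf) _
        _ = _ := by ring
    · push Not at hk
      obtain ⟨i, rfl⟩ := hk
      rw [tsum_eq_single (τ i)]
      · calc _ ≤ attach (graphOf m f) (ε i / m) (τ i) * (present ε τ f *
              (potential m ε τ (Fin.snoc (α := fun _ => ℕ) f (τ i)) : ENNReal)) := by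
              gcongr
              exact present_snoc_le f _
          _ = present ε τ f * (attach (graphOf m f) (ε i / m) (τ i) *
              (potential m ε τ (Fin.snoc (α := fun _ => ℕ) f (τ i)) : ENNReal)) := by ring
          _ ≤ present ε τ f * (stepFactor m ε τ (ε i) * potential m ε τ f) :=
              mul_le_mul_right (step_of_eq hm hε i hf) _
          _ = _ := by ring
      · intro y hy
        rw [present_snoc_eq_zero i f hy]
        simp

end Prescribed

/-! ### Numerical bounds for the step factors -/

/-- Telescopes from (1 + 1/(2t + 1))² ≤ (4t + 5)/(4t + 1); after clearing denominators the two sides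
differ by 1. -/
theorem prod_one_add_inv_le {a e : ℕ} (h : a ≤ e) :
    ∏ t ∈ Ico a e, (1 + (2 * (t : ℝ) + 1)⁻¹) ≤ √((4 * e + 1) / (4 * a + 1)) := by
  induction e, h using Nat.le_induction with
  | base =>
    rw [div_self (by positivity)]
    simp
  | succ e h ih =>
    rw [Finset.prod_Ico_succ_top h]
    have h1 : 1 + (2 * (e : ℝ) + 1)⁻¹ ≤ √((4 * (e + 1 : ℕ) + 1) / (4 * e + 1)) := by
      apply Real.le_sqrt_of_sq_le
      rw [le_div_iff₀ (by positivity)]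
      push_cast
      have : (1 + (2 * (e : ℝ) + 1)⁻¹) ^ 2 * (2 * e + 1) ^ 2 = (2 * e + 2) ^ 2 := by
        field_simp
        ring
      have h2 : (0 : ℝ) < (2 * e + 1) ^ 2 := by positivity
      have he : (0 : ℝ) ≤ e := by positivity
      nlinarith
    calc _ ≤ √((4 * e + 1) / (4 * a + 1)) * √((4 * (e + 1 : ℕ) + 1) / (4 * e + 1)) := by
          gcongr
      _ = _ := by
          rw [← Real.sqrt_mul (by positivity)]
          congr 1
          field_simp

theorem inv_mul_prod_le {m e x : ℕ} (hm : 1 ≤ m) (h : m * x ≤ e) :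
    (2 * (e : ℝ) + 1)⁻¹ * ∏ t ∈ Ico (m * x) e, (1 + (2 * (t : ℝ) + 1)⁻¹) ≤
      √2 / √((e + 1) * (x + 1)) := by
  refine (mul_le_mul_of_nonneg_left (prod_one_add_inv_le h) (by positivity)).trans ?_
  rw [← Real.sqrt_div (by positivity)]
  apply Real.le_sqrt_of_sq_le
  rw [mul_pow, Real.sq_sqrt (by positivity), inv_pow, inv_mul_eq_div, div_div,
    div_le_div_iff₀ (by positivity) (by positivity)]
  have h1 : (1 : ℝ) ≤ m := by exact_mod_cast hm
  have he : (0 : ℝ) ≤ e := by positivity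
  have hx : (0 : ℝ) ≤ x := by positivity
  have h2 : (x : ℝ) ≤ m * x := by nlinarith
  push_cast
  have h3 : (4 * (e : ℝ) + 1) * (e + 1) ≤ 2 * (2 * e + 1) ^ 2 := by nlinarith
  have h4 : (x : ℝ) + 1 ≤ 4 * (m * x) + 1 ∨ x = 0 := by
    rcases Nat.eq_zero_or_pos x with h | h
    · exact Or.inr h
    · left
      have : (1 : ℝ) ≤ x := by exact_mod_cast h
      nlinarith
  have h5 : (x : ℝ) + 1 ≤ 4 * (m * x) + 1 := by nlinarith
  calc (4 * (e : ℝ) + 1) * ((e + 1) * (x + 1)) = ((4 * (e : ℝ) + 1) * (e + 1)) * (x + 1) := by ring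
    _ ≤ (2 * (2 * e + 1) ^ 2) * (4 * (m * x) + 1) := by gcongr
    _ = _ := by ring

/-- After exchanging the products, each prescribed edge e into x has a factor 1/(2e + 1) at its own
time and the growth factors between the arrival of x and e. These are of order 1/e and √(e/x),
whence 1/√(ex). -/
theorem prod_stepFactor_le {ι : Type*} [Fintype ι] {m k : ℕ} (hm : 1 ≤ m) {ε τ : ι → ℕ}
    (hk : ∀ i, ε i < k) (hτ : ∀ i, m * τ i ≤ ε i) :
    ∏ t ∈ range k, stepFactor m ε τ t ≤
      ∏ i, ENNReal.ofReal (√2 / √((ε i + 1) * (τ i + 1))) := by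
  unfold stepFactor
  rw [Finset.prod_comm]
  refine Finset.prod_le_prod' fun i _ => ?_
  have h1 : ∀ t ∈ range k, (if ε i = t then ((2 * t + 1 : ℕ) : ENNReal)⁻¹
      else if m * τ i ≤ t ∧ t < ε i then 1 + ((2 * t + 1 : ℕ) : ENNReal)⁻¹ else 1) =
      (if ε i = t then ENNReal.ofReal (2 * (t : ℝ) + 1)⁻¹ else 1) *
      (if t ∈ Ico (m * τ i) (ε i) then ENNReal.ofReal (1 + (2 * (t : ℝ) + 1)⁻¹) else 1) := by
    intro t _
    have h0 : ENNReal.ofReal (2 * (t : ℝ) + 1)⁻¹ = ((2 * t + 1 : ℕ) : ENNReal)⁻¹ := by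
      rw [ENNReal.ofReal_inv_of_pos (by positivity)]
      congr 1
      rw [← ENNReal.ofReal_natCast]
      push_cast
      rfl
    rw [ENNReal.ofReal_add (by norm_num) (by positivity), h0, ENNReal.ofReal_one]
    simp only [Finset.mem_Ico]
    split_ifs
    · omega
    all_goals simp
  rw [Finset.prod_congr rfl h1, Finset.prod_mul_distrib, Finset.prod_ite_eq, if_pos (by simp [hk]),
    Finset.prod_ite_mem, Finset.inter_eq_right.2, ← ENNReal.ofReal_prod_of_nonneg,
    ← ENNReal.ofReal_mul (by positivity)]
  · exact ENNReal.ofReal_le_ofReal (inv_mul_prod_le hm (hτ i))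
  · intros; positivity
  · intro t ht
    have := hk i
    simp only [Finset.mem_Ico, Finset.mem_range] at ht ⊢
    omega

theorem ascFactorial_le_pow {m R r : ℕ} (hm : 1 ≤ m) (hR : R ≤ r) :
    m.ascFactorial R ≤ (m + r) ^ R := by
  obtain ⟨m, rfl⟩ := Nat.exists_eq_add_of_le' hm
  exact (Nat.ascFactorial_le_pow_add m R).trans (Nat.pow_le_pow_left (by omega) _)

/-- The probability that prescribed edges `ε i` have prescribed targets `τ i`. -/
theorem ev_present_le {ι : Type*} [Fintype ι] {m k : ℕ} (hm : 1 ≤ m) {ε τ : ι → ℕ}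
    (hε : Function.Injective ε) (hk : ∀ i, ε i < k) (hτ : ∀ i, m * τ i ≤ ε i) :
    ev m k (present ε τ) ≤ ENNReal.ofReal ((m + Fintype.card ι : ℝ) ^ Fintype.card ι *
      ∏ i, (√2 / √((ε i + 1) * (τ i + 1)))) := by
  have h := ev_present_mul_potential_le hm hε (τ := τ) k
  -- At time `k` nothing is pending, so the potential drops out of the bound.
  have h1 : ∀ f : Fin k → ℕ, potential m ε τ f = 1 := fun f => by
    refine Finset.prod_eq_one fun x _ => ?_
    have : pending ε τ k x = 0 := Finset.sum_eq_zero fun i _ => if_neg fun hi => by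
      have := hk i
      omega
    rw [this, Nat.ascFactorial_zero]
  simp only [h1, Nat.cast_one, mul_one] at h
  refine h.trans ?_
  rw [ENNReal.ofReal_mul (by positivity), ENNReal.ofReal_prod_of_nonneg (by intros; positivity)]
  refine mul_le_mul' ?_ (prod_stepFactor_le hm hk hτ)
  have h2 : ∑ x ∈ univ.image τ, pending ε τ 0 x = Fintype.card ι := by
    -- With both parameters 0 every arrival and time condition holds, so the sum counts all
    -- prescribed edges.
    have := sum_pending 0 ε τ 0
    simpa using this
  have h3 : ∏ x ∈ univ.image τ, m.ascFactorial (pending ε τ 0 x) ≤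
      (m + Fintype.card ι) ^ Fintype.card ι := by
    calc _ ≤ ∏ x ∈ univ.image τ, (m + Fintype.card ι) ^ pending ε τ 0 x := by
          refine Finset.prod_le_prod' fun x _ => ascFactorial_le_pow hm ?_
          unfold pending
          rw [← Finset.card_filter]
          exact Finset.card_le_univ _
      _ = _ := by rw [Finset.prod_pow_eq_pow_sum, h2]
  rw [← Nat.cast_prod]
  refine (Nat.cast_le.2 h3).trans (le_of_eq ?_)
  rw [← ENNReal.ofReal_natCast]
  push_cast
  rfl

/-! ### Anticoncentration of degrees -/

open Classical in
-- Once `v` has inserted all its own edges, P_{k+1}(x) = ((2k + 1 - x) P_k(x) + (x - 1) P_k(x - 1))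
-- / (2k + 1). The coefficients add up to 2k/(2k + 1), so the largest point mass contracts.
theorem ev_degree_eq_succ_le {m k : ℕ} (hm : 1 ≤ m) {v : ℕ} (hk : m * (v + 1) ≤ k) {B : ENNReal}
    (hB : ∀ x, ev m k (fun f => if degree (graphOf m f) v = x then 1 else 0) ≤ B) (x : ℕ) :
    ev m (k + 1) (fun f => if degree (graphOf m f) v = x then 1 else 0) ≤
      ((2 * k : ℕ) : ENNReal) / ((2 * k + 1 : ℕ) : ENNReal) * B := by
  have hne : k / m ≠ v := by
    have : v + 1 ≤ k / m := (Nat.le_div_iff_mul_le (by omega)).2 (by rwa [mul_comm])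
    omega
  have hdeg : ∀ (f : Fin k → ℕ) (y : ℕ),
      degree (graphOf m (Fin.snoc (α := fun _ => ℕ) f y)) v =
        degree (graphOf m f) v + if y = v then 1 else 0 := fun f y => by
    rw [degree_graphOf, degree_graphOf, hits_snoc, outs_succ, if_neg hne]
    ring
  have hle : ∀ f : Fin k → ℕ, degree (graphOf m f) v ≤ 2 * k := fun f => by
    refine (Multiset.count_le_card _ _).trans (le_of_eq ?_)
    rw [card_endpoints, card_graphOf]
  have hge : ∀ f : Fin k → ℕ, 1 ≤ degree (graphOf m f) v := fun f => by
    rw [degree_graphOf, outs_eq hm]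
    rw [mul_add] at hk
    omega
  set M : ENNReal := ((2 * k + 1 : ℕ) : ENNReal)
  have hM : M ≠ 0 := by simp [M]
  have hM' : M ≠ ⊤ := ENNReal.natCast_ne_top _
  have hat : ∀ f : Fin k → ℕ, attach (graphOf m f) (k / m) v =
      (degree (graphOf m f) v : ENNReal) / M := fun f => by
    rw [attach_apply, card_graphOf, if_neg hne.symm, add_zero]
  have hco : ∀ f : Fin k → ℕ, ∑' y, attach (graphOf m f) (k / m) y * (if y = v then 0 else 1) =
      ((2 * k + 1 - degree (graphOf m f) v : ℕ) : ENNReal) / M := fun f => by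
    have h1 : ∑' y, attach (graphOf m f) (k / m) y * (if y = v then 0 else 1) +
        attach (graphOf m f) (k / m) v = 1 := by
      have h2 : ∑' y, attach (graphOf m f) (k / m) y * (if y = v then 1 else 0) =
          attach (graphOf m f) (k / m) v := by
        rw [tsum_eq_single v (fun y hy => by simp [hy])]
        simp
      rw [← h2, ← ENNReal.tsum_add, ← PMF.tsum_coe (attach (graphOf m f) (k / m))]
      refine tsum_congr fun y => ?_
      split_ifs <;> simp
    have h3 : ((2 * k + 1 - degree (graphOf m f) v : ℕ) : ENNReal) / M +
        attach (graphOf m f) (k / m) v = 1 := by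
      rw [hat, ENNReal.div_add_div_same, ← Nat.cast_add, Nat.sub_add_cancel ((hle f).trans (by omega))]
      exact ENNReal.div_self hM hM'
    have hfin : attach (graphOf m f) (k / m) v ≠ ⊤ := PMF.apply_ne_top _ _
    exact (ENNReal.add_left_inj hfin).1 (h1.trans h3.symm)
  have key : ∀ f : Fin k → ℕ,
      ∑' y, attach (graphOf m f) (k / m) y *
        (if degree (graphOf m (Fin.snoc (α := fun _ => ℕ) f y)) v = x then 1 else 0) =
      ((2 * k + 1 - x : ℕ) : ENNReal) / M * (if degree (graphOf m f) v = x then 1 else 0) +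
        ((x - 1 : ℕ) : ENNReal) / M * (if degree (graphOf m f) v = x - 1 then 1 else 0) := by
    intro f
    simp only [hdeg]
    have hsplit : ∀ y, attach (graphOf m f) (k / m) y *
        (if (degree (graphOf m f) v + if y = v then 1 else 0) = x then 1 else 0) =
        attach (graphOf m f) (k / m) y * (if y = v then 0 else 1) *
          (if degree (graphOf m f) v = x then 1 else 0) +
        attach (graphOf m f) (k / m) y * (if y = v then 1 else 0) *
          (if degree (graphOf m f) v = x - 1 then 1 else 0) := by
      intro y
      have := hge f
      have h4 : degree (graphOf m f) v + 1 = x ↔ degree (graphOf m f) v = x - 1 := by omega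
      by_cases hy : y = v
      · simp [hy, h4]
      · simp [hy]
    rw [tsum_congr hsplit, ENNReal.tsum_add, ENNReal.tsum_mul_right, ENNReal.tsum_mul_right, hco,
      tsum_eq_single v (fun y hy => by simp [hy]), if_pos rfl, mul_one, hat]
    congr 1
    · split_ifs with h
      · rw [h]
      · rw [mul_zero, mul_zero]
    · split_ifs with h
      · rw [h]
      · rw [mul_zero, mul_zero]
  rw [ev_succ]
  simp only [key]
  have hadd : ∀ F G : (Fin k → ℕ) → ENNReal, ev m k (fun f => F f + G f) = ev m k F + ev m k G := by
    intro F G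
    simp only [ev, mul_add, ENNReal.tsum_add]
  rw [hadd, ev_const_mul, ev_const_mul]
  -- The truncated subtractions make the coefficients unreliable for `x > 2 * k + 1` and for `x =
  -- 0`; there the point masses themselves vanish.
  rcases Nat.lt_or_ge (2 * k + 1) x with hx | hx
  · have h0 : ∀ z, 2 * k < z →
        ev m k (fun f => if degree (graphOf m f) v = z then 1 else 0) = 0 := fun z hz => by
      rw [ev, ENNReal.tsum_eq_zero]
      intro f
      rw [if_neg (by have := hle f; omega), mul_zero]
    rw [h0 x (by omega), h0 (x - 1) (by omega)]
    simp
  · rcases Nat.eq_zero_or_pos x with rfl | hx0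
    · have h0 : ev m k (fun f => if degree (graphOf m f) v = 0 then 1 else 0) = 0 := by
        rw [ev, ENNReal.tsum_eq_zero]
        intro f
        rw [if_neg (by have := hge f; omega), mul_zero]
      simp [h0]
    · calc _ ≤ ((2 * k + 1 - x : ℕ) : ENNReal) / M * B + ((x - 1 : ℕ) : ENNReal) / M * B := by
            gcongr
            · exact hB x
            · exact hB _
        _ = _ := by
            rw [← add_mul, ENNReal.div_add_div_same, ← Nat.cast_add]
            congr 4
            omega

/-- Makes the contraction factors telescope to a square root. -/
theorem two_mul_div_le {k : ℕ} (hk : 1 ≤ k) :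
    (2 * k : ℝ) / (2 * k + 1) ≤ √(k / (k + 1)) := by
  apply Real.le_sqrt_of_sq_le
  have : (1 : ℝ) ≤ k := by exact_mod_cast hk
  rw [div_pow, div_le_div_iff₀ (by positivity) (by positivity)]
  nlinarith

open Classical in
/-- A degree takes no value with large probability. -/
theorem ev_degree_eq_le {m : ℕ} (hm : 1 ≤ m) (v : ℕ) {k : ℕ} (hk : m * (v + 1) ≤ k) (x : ℕ) :
    ev m k (fun f => if degree (graphOf m f) v = x then 1 else 0) ≤
      ENNReal.ofReal √((m * (v + 1) : ℕ) / k) := by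
  have hpos : 1 ≤ m * (v + 1) := Nat.mul_pos hm (Nat.succ_pos v)
  induction k, hk using Nat.le_induction generalizing x with
  | base =>
    have : (0 : ℝ) < (m * (v + 1) : ℕ) := by exact_mod_cast hpos
    rw [div_self this.ne', Real.sqrt_one, ENNReal.ofReal_one]
    refine (ev_mono (G := fun _ => 1) fun f _ => ?_).trans (ev_const _ _ _).le
    split_ifs <;> simp
  | succ k hk ih =>
    refine (ev_degree_eq_succ_le hm hk ih x).trans ?_
    have hk0 : (0 : ℝ) < k := by exact_mod_cast hpos.trans hk
    have h1 : ((2 * k : ℕ) : ENNReal) / ((2 * k + 1 : ℕ) : ENNReal) =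
        ENNReal.ofReal ((2 * k : ℝ) / (2 * k + 1)) := by
      rw [ENNReal.ofReal_div_of_pos (by positivity), ← ENNReal.ofReal_natCast,
        ← ENNReal.ofReal_natCast]
      push_cast
      rfl
    rw [h1, ← ENNReal.ofReal_mul (by positivity)]
    apply ENNReal.ofReal_le_ofReal
    calc _ ≤ √(k / (k + 1)) * √((m * (v + 1) : ℕ) / k) := by
          gcongr
          exact two_mul_div_le (hpos.trans hk)
      _ = _ := by
          rw [← Real.sqrt_mul (by positivity)]
          congr 1
          push_cast
          field_simp

/-! ### Nodes joined to two given nodes by different edges -/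

/-- The edge number `e` joins `a` and `b`, where the later of the two nodes is the source. -/
def Joins (m : ℕ) {k : ℕ} (f : Fin k → ℕ) (e : Fin k) (a b : ℕ) : Prop :=
  (e : ℕ) / m = max a b ∧ f e = min a b

open Classical in
/-- The nodes other than `u` and `v` which are joined to `u` and to `v` by different edges. -/
noncomputable def shared (m n : ℕ) {k : ℕ} (f : Fin k → ℕ) (u v : ℕ) : Finset ℕ :=
  (range n).filter fun a => a ≠ u ∧ a ≠ v ∧
    ∃ e e' : Fin k, e ≠ e' ∧ Joins m f e a u ∧ Joins m f e' a v

/-- The source of the edge number `j` of the later of the nodes `a i` and `w b`. -/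
def pairEdge (m : ℕ) {n r : ℕ} (a : Fin r → Fin n) (w : Bool → ℕ) (κ : Fin r × Bool → Fin m)
    (i : Fin r × Bool) : ℕ := m * max (a i.1 : ℕ) (w i.2) + κ i

/-- The earlier of the nodes `a i` and `w b`. -/
def pairTarget {n r : ℕ} (a : Fin r → Fin n) (w : Bool → ℕ) (i : Fin r × Bool) : ℕ :=
  min (a i.1 : ℕ) (w i.2)

/-- A tuple of distinct shared nodes produces 2r distinct edges: two equal ones would join the same
unordered pair, which forces the same shared node, and its two edges differ by definition. This
argument also covers `w true = w false`. The offset κ records the position of an edge among the `m`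
edges of its source. -/
theorem exists_pairEdge {m n r : ℕ} (hm : 1 ≤ m) (f : Fin (n * m) → ℕ) (w : Bool → ℕ)
    (a : Fin r → Fin n) (ha : Function.Injective a)
    (hs : ∀ i, (a i : ℕ) ∈ shared m n f (w true) (w false)) :
    ∃ κ : Fin r × Bool → Fin m, Function.Injective (pairEdge m a w κ) ∧
      present (pairEdge m a w κ) (pairTarget a w) f = 1 := by
  classical
  simp only [shared, Finset.mem_filter] at hs
  choose _ h1 h2 e e' hne he he' using hs
  let E : Fin r × Bool → Fin (n * m) := fun i => if i.2 then e i.1 else e' i.1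
  have hE : ∀ i, Joins m f (E i) (a i.1) (w i.2) := by
    rintro ⟨i, b⟩
    cases b
    · exact he' i
    · exact he i
  have haw : ∀ i b, (a i : ℕ) ≠ w b := by
    intro i b
    cases b
    · exact h2 i
    · exact h1 i
  have hEinj : Function.Injective E := by
    rintro ⟨i, b⟩ ⟨j, c⟩ hij
    have g1 := hE (i, b)
    have g2 := hE (j, c)
    rw [hij] at g1
    have q1 := g1.1.symm.trans g2.1
    have q2 := g1.2.symm.trans g2.2
    simp only at q1 q2
    have := haw i c
    have hab : (a i : ℕ) = a j := by omega
    obtain rfl : i = j := ha (Fin.ext hab)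
    rw [Prod.mk.injEq]
    refine ⟨rfl, ?_⟩
    cases b <;> cases c <;> simp_all [E]
    all_goals first | exact hne i hij | exact hne i hij.symm
  have hval : ∀ i, ((E i : ℕ)) = m * max (a i.1 : ℕ) (w i.2) + (E i : ℕ) % m := fun i => by
    rw [← (hE i).1]
    exact (Nat.div_add_mod _ _).symm
  let κ : Fin r × Bool → Fin m := fun i => ⟨(E i : ℕ) % m, Nat.mod_lt _ hm⟩
  have hκ : pairEdge m a w κ = fun i => (E i : ℕ) := by
    funext i
    exact (hval i).symm
  refine ⟨κ, ?_, ?_⟩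
  · rw [hκ]
    exact fun i j hij => hEinj (Fin.ext hij)
  · rw [present, if_pos]
    rw [hκ]
    intro i hi
    exact (hE i).2

/-- The descending factorial counts injective r-tuples of shared nodes, and each of them is
witnessed by at least one choice of offsets. -/
theorem descFactorial_card_shared_le {m n r : ℕ} (hm : 1 ≤ m) (f : Fin (n * m) → ℕ)
    (w : Bool → ℕ) [∀ (a : Fin r → Fin n) κ, Decidable (Function.Injective (pairEdge m a w κ))] :
    ((shared m n f (w true) (w false)).card.descFactorial r : ENNReal) ≤
      ∑ a : Fin r → Fin n, ∑ κ : Fin r × Bool → Fin m,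
        if Function.Injective (pairEdge m a w κ) then
          present (pairEdge m a w κ) (pairTarget a w) f else 0 := by
  classical
  set S := shared m n f (w true) (w false)
  have hlt : ∀ x ∈ S, x < n := fun x hx => by
    simp only [S, shared, Finset.mem_filter, Finset.mem_range] at hx
    exact hx.1
  let Φ : (Fin r ↪ S) → (Fin r → Fin n) := fun g i => ⟨g i, hlt _ (g i).2⟩
  have hΦ : Function.Injective Φ := by
    intro g g' h
    ext i
    have := congrFun h i
    simpa [Φ] using this
  have h1 : S.card.descFactorial r = (univ.image Φ).card := by
    rw [Finset.card_image_of_injective _ hΦ, Finset.card_univ, Fintype.card_embedding_eq]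
    simp
  rw [h1, Finset.card_eq_sum_ones, Nat.cast_sum]
  refine (Finset.sum_le_sum fun a ha => ?_).trans
    (Finset.sum_le_sum_of_subset (Finset.subset_univ _))
  obtain ⟨g, -, rfl⟩ := Finset.mem_image.1 ha
  have hg : Function.Injective (Φ g) := by
    intro i j hij
    apply g.injective
    apply Subtype.ext
    simpa [Φ] using hij
  obtain ⟨κ, hκ, hp⟩ := exists_pairEdge hm f w (Φ g) hg (fun i => (g i).2)
  refine le_trans ?_ (Finset.single_le_sum (fun _ _ => zero_le) (Finset.mem_univ κ))
  rw [if_pos hκ, hp, Nat.cast_one]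

/-- The bound for an edge between a and w is symmetric, as (max + 1)(min + 1) = (a + 1)(w + 1). The
two edges at a together give 1/(a + 1), which later sums to a harmonic number. -/
theorem ev_pairEdge_le {m n r : ℕ} (hm : 1 ≤ m) {w : Bool → ℕ} (hw : ∀ b, w b < n)
    (a : Fin r → Fin n) (κ : Fin r × Bool → Fin m)
    (hi : Function.Injective (pairEdge m a w κ)) :
    ev m (n * m) (present (pairEdge m a w κ) (pairTarget a w)) ≤
      ENNReal.ofReal ((m + r * 2 : ℝ) ^ (r * 2) *
        ∏ i, (2 * ((a i : ℝ) + 1)⁻¹ / √((w true + 1) * (w false + 1)))) := by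
  have hmax : ∀ i : Fin r × Bool, max (a i.1 : ℕ) (w i.2) < n := fun i =>
    max_lt (a i.1).2 (hw _)
  refine (ev_present_le hm hi (fun i => ?_) (fun i => ?_)).trans (ENNReal.ofReal_le_ofReal ?_)
  · have h1 := Nat.mul_le_mul_left m (hmax i)
    have h2 := (κ i).2
    simp only [pairEdge]
    rw [Nat.succ_eq_add_one, mul_add, mul_comm m n] at h1
    omega
  · have : pairTarget a w i ≤ max (a i.1 : ℕ) (w i.2) := by simp [pairTarget]
    exact (Nat.mul_le_mul_left m this).trans (Nat.le_add_right _ _)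
  · simp only [Fintype.card_prod, Fintype.card_fin, Fintype.card_bool, Nat.cast_mul,
      Nat.cast_ofNat]
    refine mul_le_mul_of_nonneg_left ?_ (by positivity)
    rw [Fintype.prod_prod_type]
    refine Finset.prod_le_prod (fun _ _ => by positivity) fun i _ => ?_
    rw [Fintype.prod_bool]
    have h : ∀ b, √2 / √(((pairEdge m a w κ (i, b) : ℕ) + 1 : ℝ) * ((pairTarget a w (i, b) : ℕ) + 1)) ≤
        √2 / √(((a i : ℝ) + 1) * (w b + 1)) := by
      intro b
      refine div_le_div_of_nonneg_left (by positivity) (by positivity) (Real.sqrt_le_sqrt ?_)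
      have h1 : max (a i : ℕ) (w b) ≤ pairEdge m a w κ (i, b) :=
        (Nat.le_mul_of_pos_left _ hm).trans (Nat.le_add_right _ _)
      have h2 : ((a i : ℕ) + 1) * (w b + 1) = (max (a i : ℕ) (w b) + 1) * (min (a i : ℕ) (w b) + 1) := by
        rcases le_total (a i : ℕ) (w b) with h | h
        · rw [max_eq_right h, min_eq_left h, mul_comm]
        · rw [max_eq_left h, min_eq_right h]
      have h3 : ((a i : ℕ) + 1) * (w b + 1) ≤
          (pairEdge m a w κ (i, b) + 1) * (pairTarget a w (i, b) + 1) := by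
        rw [h2]
        exact Nat.mul_le_mul_right _ (Nat.succ_le_succ h1)
      exact_mod_cast h3
    refine (mul_le_mul (h true) (h false) (by positivity) (by positivity)).trans (le_of_eq ?_)
    have ha : (0 : ℝ) ≤ (a i : ℝ) + 1 := by positivity
    rw [div_mul_div_comm, Real.mul_self_sqrt (by norm_num), Real.sqrt_mul ha, Real.sqrt_mul ha,
      Real.sqrt_mul (by positivity), ← div_eq_mul_inv, div_div]
    congr 1
    have := Real.mul_self_sqrt ha
    linear_combination (√((w true : ℝ) + 1) * √((w false : ℝ) + 1)) * this

/-- Factorial moments of the number of shared nodes. -/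
theorem ev_descFactorial_shared_le {m n : ℕ} (hm : 1 ≤ m) {u v : ℕ} (hu : u < n) (hv : v < n)
    (r : ℕ) :
    ev m (n * m) (fun f => ((shared m n f u v).card.descFactorial r : ENNReal)) ≤
      ENNReal.ofReal ((m : ℝ) ^ (r * 2) * (m + r * 2 : ℝ) ^ (r * 2) *
        (2 * (harmonic n : ℝ) / √((u + 1) * (v + 1))) ^ r) := by
  classical
  let w : Bool → ℕ := fun b => if b then u else v
  have hw : ∀ b, w b < n := fun b => by cases b <;> simp [w, hu, hv]
  have h0 := ev_mono (m := m) (k := n * m) fun f _ =>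
    descFactorial_card_shared_le (r := r) hm f w
  refine h0.trans ?_
  rw [ev_finset_sum]
  simp only [ev_finset_sum]
  have h1 : ∀ (a : Fin r → Fin n) (κ : Fin r × Bool → Fin m),
      ev m (n * m) (fun f => if Function.Injective (pairEdge m a w κ) then
          present (pairEdge m a w κ) (pairTarget a w) f else 0) ≤
        ENNReal.ofReal ((m + r * 2 : ℝ) ^ (r * 2) *
          ∏ i, (2 * ((a i : ℝ) + 1)⁻¹ / √((u + 1) * (v + 1)))) := by
    intro a κ
    by_cases hi : Function.Injective (pairEdge m a w κ)
    · simp only [hi, if_true]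
      exact ev_pairEdge_le hm hw a κ hi
    · simp only [hi, if_false]
      rw [ev_const]
      exact zero_le
  refine (Finset.sum_le_sum fun a _ => Finset.sum_le_sum fun κ _ => h1 a κ).trans (le_of_eq ?_)
  simp only [Finset.sum_const, Finset.card_univ, Fintype.card_fun, Fintype.card_prod,
    Fintype.card_fin, Fintype.card_bool, nsmul_eq_mul, ← Finset.mul_sum]
  -- The bound is a product over the tuple, so the sum over tuples is the r-th power of one harmonic
  -- sum; the offsets contribute `m ^ (2 * r)`.
  rw [← ENNReal.ofReal_sum_of_nonneg (by intros; positivity), ← Finset.mul_sum,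
    ← Fintype.sum_pow (fun a : Fin n => 2 * ((a : ℝ) + 1)⁻¹ / √((u + 1) * (v + 1))) r,
    ← ENNReal.ofReal_natCast, ← ENNReal.ofReal_mul (by positivity)]
  congr 1
  push_cast
  rw [mul_assoc]
  congr 3
  rw [← Finset.sum_div, ← Finset.mul_sum, harmonic,
    Fin.sum_univ_eq_sum_range (fun a => ((a : ℝ) + 1)⁻¹)]
  push_cast
  rfl

/-! ### The expected degree -/

theorem sum_inv_sqrt_le (k : ℕ) : ∑ e ∈ range k, (√((e : ℝ) + 1))⁻¹ ≤ 2 * √k := by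
  induction k with
  | zero => simp
  | succ k ih =>
    rw [Finset.sum_range_succ]
    have h1 : (√((k : ℝ) + 1))⁻¹ ≤ 2 * (√(k + 1) - √k) := by
      have h2 := Real.sq_sqrt (show (0 : ℝ) ≤ k + 1 by positivity)
      have h3 := Real.sq_sqrt (show (0 : ℝ) ≤ k by positivity)
      have h4 : 0 < √((k : ℝ) + 1) := by positivity
      rw [inv_le_iff_one_le_mul₀ h4]
      nlinarith [sq_nonneg (√((k : ℝ) + 1) - √k)]
    push_cast
    linarith

/-- The expectation of a degree. -/
theorem ev_degree_le {m : ℕ} (hm : 1 ≤ m) (k v : ℕ) :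
    ev m k (fun f => (degree (graphOf m f) v : ENNReal)) ≤
      ENNReal.ofReal (m + 4 * (m + 1) * √k) := by
  classical
  -- Each hit is a prescription of a single edge, indexed by `Unit`.
  have h1 : ∀ f : Fin k → ℕ, paTargets m k f ≠ 0 → (degree (graphOf m f) v : ENNReal) ≤
      (m : ENNReal) + ∑ e : Fin k, if m * v ≤ e then
        present (fun _ : Unit => (e : ℕ)) (fun _ => v) f else 0 := by
    intro f hf
    rw [degree_graphOf, Nat.cast_add]
    refine add_le_add ?_ ?_
    · rw [outs_eq hm]
      exact_mod_cast min_le_right _ _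
    · rw [hits, Nat.cast_sum]
      refine Finset.sum_le_sum fun e _ => ?_
      split_ifs with h h'
      · simp [present, h]
      · have h2 := le_source_of_paTargets_ne_zero f hf e
        have h3 := Nat.mul_div_le (e : ℕ) m
        have h4 := Nat.mul_le_mul_left m h2
        rw [h] at h4
        exact absurd (h4.trans h3) h'
      all_goals simp
  refine (ev_mono h1).trans ?_
  have hadd : ∀ F : (Fin k → ℕ) → ENNReal, ev m k (fun f => (m : ENNReal) + F f) = m + ev m k F := by
    intro F
    simp only [ev, mul_add, ENNReal.tsum_add, ENNReal.tsum_mul_right, PMF.tsum_coe, one_mul]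
  rw [hadd, ev_finset_sum, ENNReal.ofReal_add (by positivity) (by positivity),
    ENNReal.ofReal_natCast]
  refine add_le_add_right ?_ _
  have h2 : ∀ e : Fin k, ev m k (fun f => if m * v ≤ e then
        present (fun _ : Unit => (e : ℕ)) (fun _ => v) f else 0) ≤
      ENNReal.ofReal (2 * (m + 1) * (√((e : ℝ) + 1))⁻¹) := by
    intro e
    by_cases h : m * v ≤ e
    · simp only [h, if_true]
      refine (ev_present_le hm (Function.injective_of_subsingleton _) (fun _ => e.2)
        (fun _ => h)).trans (ENNReal.ofReal_le_ofReal ?_)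
      simp only [Fintype.card_unit, pow_one, Finset.univ_unique, Finset.prod_singleton,
        Nat.cast_one]
      have h3 : √2 ≤ 2 := by rw [Real.sqrt_le_iff]; norm_num
      have h4 : √((e : ℝ) + 1) ≤ √((e + 1) * ((v : ℝ) + 1)) := by
        apply Real.sqrt_le_sqrt
        have : (0 : ℝ) ≤ v := by positivity
        have : (0 : ℝ) ≤ (e : ℕ) := by positivity
        nlinarith
      calc ((m : ℝ) + 1) * (√2 / √((e + 1) * ((v : ℝ) + 1))) ≤
          (m + 1) * (2 / √((e : ℝ) + 1)) := by gcongr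
        _ = _ := by rw [div_eq_mul_inv]; ring
    · simp only [h, if_false]
      rw [ev_const]
      exact zero_le
  refine (Finset.sum_le_sum fun e _ => h2 e).trans ?_
  rw [← ENNReal.ofReal_sum_of_nonneg (by intros; positivity), ← Finset.mul_sum,
    Fin.sum_univ_eq_sum_range (fun e => (√((e : ℝ) + 1))⁻¹)]
  apply ENNReal.ofReal_le_ofReal
  have := sum_inv_sqrt_le k
  calc _ ≤ 2 * ((m : ℝ) + 1) * (2 * √k) := by gcongr
    _ = _ := by ring

/-! ### Neighbourhoods in the underlying graph -/

theorem adj_survivors_iff {m k : ℕ} {f : Fin k → ℕ} {β : Fin k → Bool} {a b : ℕ} :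
    Adj (survivors m f β) a b ↔
      ∃ e : Fin k, β e = true ∧
        (((e : ℕ) / m = a ∧ f e = b) ∨ ((e : ℕ) / m = b ∧ f e = a)) := by
  simp only [Adj, survivors, Multiset.mem_map, Prod.mk.injEq, Finset.mem_val, Finset.mem_filter,
    Finset.mem_univ, true_and, and_or_left, exists_or]

theorem exists_joins {m k : ℕ} {f : Fin k → ℕ} (hf : ∀ e, f e ≤ e / m) {β : Fin k → Bool}
    {a b : ℕ} (h : Adj (survivors m f β) a b) : ∃ e, Joins m f e a b := by
  obtain ⟨e, -, h⟩ := adj_survivors_iff.1 h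
  refine ⟨e, ?_⟩
  have := hf e
  unfold Joins
  omega

/-- Edges from a third node to `u` and to `v` are different because `u ≠ v`. The 2 allows for `u`
and `v` themselves as common neighbours. -/
theorem card_common_le {m n k : ℕ} {f : Fin k → ℕ} (hf : ∀ e, f e ≤ e / m)
    (β β' : Fin k → Bool) {u v : ℕ} (huv : u ≠ v) :
    ((range n).filter fun a => Adj (survivors m f β) a u ∧ Adj (survivors m f β') a v).card ≤
      (shared m n f u v).card + 2 := by
  classical
  calc _ ≤ (shared m n f u v ∪ {u, v}).card := by
        refine Finset.card_le_card fun a ha => ?_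
        simp only [Finset.mem_filter] at ha
        simp only [Finset.mem_union, Finset.mem_insert, Finset.mem_singleton, shared,
          Finset.mem_filter]
        refine or_iff_not_imp_right.2 fun hcon => ?_
        push Not at hcon
        obtain ⟨e, he⟩ := exists_joins hf ha.2.1
        obtain ⟨e', he'⟩ := exists_joins hf ha.2.2
        refine ⟨ha.1, hcon.1, hcon.2, e, e', ?_, he, he'⟩
        rintro rfl
        have h1 := he.1.symm.trans he'.1
        have h2 := he.2.symm.trans he'.2
        omega
    _ ≤ _ := (Finset.card_union_le _ _).trans (by gcongr; exact Finset.card_le_two)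

open Classical in
/-- The nodes other than `v` which sent an edge to `v`. -/
noncomputable def senders (m n : ℕ) {k : ℕ} (f : Fin k → ℕ) (v : ℕ) : Finset ℕ :=
  (range n).filter fun a => a ≠ v ∧ ∃ e : Fin k, (e : ℕ) / m = a ∧ f e = v

/-- The edges of `v` itself account for at most 2m, self-loops included. Any other node adds one as
a sender, unless it sent several edges; then it is shared between `v` and `v`, and it sent at most
`m`. -/
theorem degree_le_card_senders {m n : ℕ} (hm : 1 ≤ m) {f : Fin (n * m) → ℕ}
    (hf : ∀ e, f e ≤ e / m) (v : ℕ) :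
    degree (graphOf m f) v ≤
      2 * m + (senders m n f v).card + m * (shared m n f v v).card := by
  classical
  let X : ℕ → ℕ := fun a => (univ.filter fun e : Fin (n * m) => (e : ℕ) / m = a ∧ f e = v).card
  have hX : ∀ a, X a ≤ m := fun a => by
    calc X a ≤ outs m (n * m) a := by
          rw [outs, ← Finset.card_filter]
          exact Finset.card_le_card fun e he => by
            simp only [Finset.mem_filter] at he ⊢
            exact ⟨he.1, he.2.1⟩
      _ ≤ m := by rw [outs_eq hm]; exact min_le_right _ _
  have hhits : hits f v = ∑ a ∈ range n, X a := by
    rw [hits, ← Finset.card_filter]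
    refine (Finset.card_eq_sum_card_fiberwise (f := fun e : Fin (n * m) => (e : ℕ) / m)
      (t := range n) ?_).trans ?_
    rotate_left
    · refine Finset.sum_congr rfl fun a _ => ?_
      rw [Finset.filter_filter]
      simp only [X, and_comm]
    · intro e _
      simp only [Finset.coe_range, Set.mem_Iio]
      exact Nat.div_lt_of_lt_mul (e.2.trans_eq (mul_comm _ _))
  have hXle : ∀ a ∈ range n, X a ≤ (if a = v then m else 0) +
      (if a ∈ senders m n f v then 1 else 0) + m * (if a ∈ shared m n f v v then 1 else 0) := by
    intro a ha
    by_cases hav : a = v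
    · rw [if_pos hav]
      have := hX a
      omega
    rcases Nat.lt_or_ge (X a) 2 with h | h
    · rcases Nat.eq_zero_or_pos (X a) with h0 | h0
      · omega
      · obtain ⟨e, he⟩ := Finset.card_pos.1 h0
        simp only [Finset.mem_filter] at he
        have : a ∈ senders m n f v := by
          simp only [senders, Finset.mem_filter]
          exact ⟨ha, hav, e, he.2⟩
        rw [if_pos this]
        omega
    · obtain ⟨e, he, e', he', hne⟩ := Finset.one_lt_card.1 h
      simp only [Finset.mem_filter] at he he'
      have hge := hf e
      have hge' := hf e'
      have : a ∈ shared m n f v v := by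
        simp only [shared, Finset.mem_filter]
        refine ⟨ha, hav, hav, e, e', hne, ⟨?_, ?_⟩, ⟨?_, ?_⟩⟩ <;> omega
      rw [if_pos this]
      have := hX a
      omega
  have hsub : ∀ S : Finset ℕ, S ⊆ range n →
      ∑ a ∈ range n, (if a ∈ S then 1 else 0) = S.card := fun S hS => by
    rw [Finset.sum_ite_mem, Finset.inter_eq_right.2 hS, Finset.card_eq_sum_ones]
  have hsum := Finset.sum_le_sum hXle
  rw [Finset.sum_add_distrib, Finset.sum_add_distrib, ← Finset.mul_sum,
    hsub (senders m n f v) (Finset.filter_subset _ _),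
    hsub (shared m n f v v) (Finset.filter_subset _ _), ← hhits,
    Finset.sum_ite_eq'] at hsum
  have hout : outs m (n * m) v ≤ m := by
    rw [outs_eq hm]
    exact min_le_right _ _
  rw [degree_graphOf]
  have : (if v ∈ range n then m else 0) ≤ m := by split_ifs <;> omega
  omega

/-! ### User-Matching makes no errors on well-separated graphs -/

/-- The number of nodes adjacent to `u` in the first and to `v` in the second graph. -/
def common (n : ℕ) (G₁ G₂ : Multigraph) (u v : ℕ) : ℕ :=
  ((range n).filter fun a => Adj G₁ a u ∧ Adj G₂ a v).card

/-- The links are true ones and contain the links in `L₀`. -/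
def TrueLinks (n : ℕ) (L₀ L : Finset (ℕ × ℕ)) : Prop :=
  L₀ ⊆ L ∧ ∀ p ∈ L, p.1 = p.2 ∧ p.1 < n

theorem score_le_common {n : ℕ} {L : Finset (ℕ × ℕ)} (hL : ∀ p ∈ L, p.1 = p.2 ∧ p.1 < n)
    (G₁ G₂ : Multigraph) (u v : ℕ) : score G₁ G₂ L u v ≤ common n G₁ G₂ u v := by
  refine Finset.card_le_card_of_injOn Prod.fst (fun p hp => ?_) (fun p hp q hq hpq => ?_)
  · simp only [Finset.coe_filter, Set.mem_ofPred_eq] at hp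
    simp only [Finset.coe_filter, Finset.mem_range, Set.mem_ofPred_eq]
    have h := hL p hp.1
    exact ⟨h.2, hp.2.1, h.1 ▸ hp.2.2⟩
  · simp only [Finset.coe_filter, Set.mem_ofPred_eq] at hp hq
    have h := hL p hp.1
    have h' := hL q hq.1
    exact Prod.ext hpq (h.1.symm.trans (hpq.trans h'.1))

theorem score_mono {L L' : Finset (ℕ × ℕ)} (h : L ⊆ L') (G₁ G₂ : Multigraph) (u v : ℕ) :
    score G₁ G₂ L u v ≤ score G₁ G₂ L' u v :=
  Finset.card_le_card (Finset.filter_subset_filter _ h)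

theorem card_adj_le_degree (n : ℕ) (G : Multigraph) (v : ℕ) :
    ((range n).filter fun a => Adj G a v).card ≤ degree G v := by
  have h : ((range n).filter fun a => Adj G a v) ⊆
      ((G.filter fun p => v = p.2).map Prod.fst + (G.filter fun p => v = p.1).map Prod.snd).toFinset := by
    intro a ha
    replace ha := (Finset.mem_filter.1 ha).2
    simp only [Multiset.mem_toFinset, Multiset.mem_add, Multiset.mem_map, Multiset.mem_filter]
    rcases ha with h | h
    · exact Or.inl ⟨(a, v), ⟨h, rfl⟩, rfl⟩
    · exact Or.inr ⟨(v, a), ⟨h, rfl⟩, rfl⟩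
  refine (Finset.card_le_card h).trans ((Multiset.toFinset_card_le _).trans (le_of_eq ?_))
  rw [degree, endpoints, Multiset.count_add, Multiset.count_map, Multiset.count_map,
    Multiset.card_add, Multiset.card_map, Multiset.card_map, add_comm]

theorem common_le_degree_left (n : ℕ) (G₁ G₂ : Multigraph) (u v : ℕ) :
    common n G₁ G₂ u v ≤ degree G₁ u :=
  (Finset.card_le_card fun a ha => by
    simp only [Finset.mem_filter] at ha ⊢
    exact ⟨ha.1, ha.2.1⟩).trans (card_adj_le_degree n G₁ u)

theorem common_le_degree_right (n : ℕ) (G₁ G₂ : Multigraph) (u v : ℕ) :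
    common n G₁ G₂ u v ≤ degree G₂ v :=
  (Finset.card_le_card fun a ha => by
    simp only [Finset.mem_filter] at ha ⊢
    exact ⟨ha.1, ha.2.2⟩).trans (card_adj_le_degree n G₂ v)

section Matching

variable {n : ℕ} {G₁ G₂ : Multigraph} {L₀ : Finset (ℕ × ℕ)} {T : ℕ}

/-- A wrong pair (u, v) with score at least `T` has at least `T` common neighbours. By `hw`, the
pair (v, v) is then eligible in the same phase and already scores more with the original links, so
(u, v) is not a strict maximum. Competing through `v` alone suffices, so eligibility has to be
transferred only from the second copy to the first. -/
theorem TrueLinks.phase {L : Finset (ℕ × ℕ)} (hL : TrueLinks n L₀ L)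
    (hw : ∀ u < n, ∀ v < n, u ≠ v → T ≤ common n G₁ G₂ u v →
      common n G₁ G₂ u v < score G₁ G₂ L₀ v v ∧ ∀ j, 2 ^ j ≤ degree G₂ v → 2 ^ j ≤ degree G₁ v)
    (j : ℕ) : TrueLinks n L₀ (phase n G₁ G₂ T j L) := by
  refine ⟨hL.1.trans Finset.subset_union_left, fun p hp => ?_⟩
  rcases Finset.mem_union.1 hp with hp | hp
  · exact hL.2 p hp
  obtain ⟨u, v⟩ := p
  obtain ⟨hp, hT, hmax⟩ := Finset.mem_filter.1 hp
  have hmem : ∀ q, q ∈ eligible n G₁ G₂ j ↔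
      (q.1 < n ∧ q.2 < n) ∧ 2 ^ j ≤ degree G₁ q.1 ∧ 2 ^ j ≤ degree G₂ q.2 := fun q => by
    simp only [eligible, Finset.mem_filter, Finset.mem_product, Finset.mem_range]
  obtain ⟨⟨hu, hv⟩, -, h2⟩ := (hmem _).1 hp
  refine ⟨?_, hu⟩
  by_contra huv
  simp only at huv
  have hle := score_le_common hL.2 G₁ G₂ u v
  obtain ⟨h3, h4⟩ := hw u hu v hv huv (hT.trans hle)
  have h5 := hmax (v, v) ((hmem _).2 ⟨⟨hv, hv⟩, h4 j h2, h2⟩)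
    (fun h => huv (congrArg Prod.fst h).symm) (Or.inr rfl)
  have h6 := score_mono hL.1 G₁ G₂ v v
  simp only at h5
  omega

theorem TrueLinks.sweep
    (hw : ∀ u < n, ∀ v < n, u ≠ v → T ≤ common n G₁ G₂ u v →
      common n G₁ G₂ u v < score G₁ G₂ L₀ v v ∧ ∀ j, 2 ^ j ≤ degree G₂ v → 2 ^ j ≤ degree G₁ v)
    (j : ℕ) {L : Finset (ℕ × ℕ)} (hL : TrueLinks n L₀ L) :
    TrueLinks n L₀ (sweep n G₁ G₂ T j L) := by
  induction j generalizing L with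
  | zero => exact hL
  | succ j ih => exact ih (hL.phase hw (j + 1))

theorem TrueLinks.iterate_sweep
    (hw : ∀ u < n, ∀ v < n, u ≠ v → T ≤ common n G₁ G₂ u v →
      common n G₁ G₂ u v < score G₁ G₂ L₀ v v ∧ ∀ j, 2 ^ j ≤ degree G₂ v → 2 ^ j ≤ degree G₁ v)
    (j k : ℕ) {L : Finset (ℕ × ℕ)} (hL : TrueLinks n L₀ L) :
    TrueLinks n L₀ ((Recon.sweep n G₁ G₂ T j)^[k] L) := by
  induction k generalizing L with
  | zero => exact hL
  | succ k ih => exact ih (hL.sweep hw j)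

/-- Every nonempty sweep ends with phase 1, whose degree threshold is 2. The true pair passes it
since its degrees are at least its score, and true links cannot lift a wrong pair above its number
of common neighbours. -/
theorem mem_sweep {v : ℕ} (hvn : v < n) (hT : 2 ≤ T)
    (hw : ∀ u < n, ∀ v < n, u ≠ v → T ≤ common n G₁ G₂ u v →
      common n G₁ G₂ u v < score G₁ G₂ L₀ v v ∧ ∀ j, 2 ^ j ≤ degree G₂ v → 2 ^ j ≤ degree G₁ v)
    (hv : T ≤ score G₁ G₂ L₀ v v)
    (hvu : ∀ u < n, u ≠ v → common n G₁ G₂ v u < score G₁ G₂ L₀ v v ∧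
      common n G₁ G₂ u v < score G₁ G₂ L₀ v v)
    {j : ℕ} (hj : 1 ≤ j) {L : Finset (ℕ × ℕ)} (hL : TrueLinks n L₀ L) :
    (v, v) ∈ sweep n G₁ G₂ T j L := by
  induction j, hj using Nat.le_induction generalizing L with
  | succ j hj ih => exact ih (hL.phase hw (j + 1))
  | base =>
    change (v, v) ∈ Recon.phase n G₁ G₂ T 1 L
    have h1 := score_mono hL.1 G₁ G₂ v v
    have h2 := score_le_common hL.2 G₁ G₂ v v
    have h3 := common_le_degree_left n G₁ G₂ v v
    have h4 := common_le_degree_right n G₁ G₂ v v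
    refine Finset.mem_union_right _ (Finset.mem_filter.2 ⟨?_, hv.trans h1, ?_⟩)
    · simp only [eligible, Finset.mem_filter, Finset.mem_product, Finset.mem_range]
      exact ⟨⟨hvn, hvn⟩, by omega, by omega⟩
    · rintro ⟨a, b⟩ hq hne hor
      simp only [eligible, Finset.mem_filter, Finset.mem_product, Finset.mem_range] at hq
      have h5 := score_le_common hL.2 G₁ G₂ a b
      simp only at hor ⊢
      rcases hor with rfl | rfl
      · have := (hvu b hq.1.2 (fun h => hne (by rw [h]))).1
        omega
      · have := (hvu a hq.1.1 (fun h => hne (by rw [h]))).2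
        omega

/-- User-Matching finds the node `v` and makes no errors. -/
theorem userMatching_correct {v : ℕ} (hvn : v < n) (hT : 2 ≤ T) {k : ℕ} (hk : 1 ≤ k)
    (hL : ∀ p ∈ L₀, p.1 = p.2 ∧ p.1 < n)
    (hw : ∀ u < n, ∀ v < n, u ≠ v → T ≤ common n G₁ G₂ u v →
      common n G₁ G₂ u v < score G₁ G₂ L₀ v v ∧ ∀ j, 2 ^ j ≤ degree G₂ v → 2 ^ j ≤ degree G₁ v)
    (hv : T ≤ score G₁ G₂ L₀ v v)
    (hvu : ∀ u < n, u ≠ v → common n G₁ G₂ v u < score G₁ G₂ L₀ v v ∧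
      common n G₁ G₂ u v < score G₁ G₂ L₀ v v) :
    (v, v) ∈ userMatching n G₁ G₂ L₀ T k ∧
      ∀ u, u ≠ v → (v, u) ∉ userMatching n G₁ G₂ L₀ T k ∧
        (u, v) ∉ userMatching n G₁ G₂ L₀ T k := by
  have h0 : TrueLinks n L₀ L₀ := ⟨subset_rfl, hL⟩
  constructor
  · obtain ⟨k, rfl⟩ := Nat.exists_eq_add_of_le' hk
    rw [userMatching, Function.iterate_succ_apply']
    refine mem_sweep hvn hT hw hv hvu ?_ (TrueLinks.iterate_sweep hw _ _ h0)
    -- The sweep is nonempty because the maximum degree is at least the score of (v, v), hence at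
    -- least 2.
    rw [Nat.le_log_iff_pow_le (by norm_num)]
    · have h1 : max (degree G₁ v) (degree G₂ v) ≤ maxDegree n G₁ G₂ :=
        Finset.le_sup (f := fun v => max (degree G₁ v) (degree G₂ v)) (Finset.mem_range.2 hvn)
      have h2 := score_le_common hL G₁ G₂ v v
      have h3 := common_le_degree_left n G₁ G₂ v v
      omega
    · have h1 : max (degree G₁ v) (degree G₂ v) ≤ maxDegree n G₁ G₂ :=
        Finset.le_sup (f := fun v => max (degree G₁ v) (degree G₂ v)) (Finset.mem_range.2 hvn)
      have h2 := score_le_common hL G₁ G₂ v v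
      have h3 := common_le_degree_left n G₁ G₂ v v
      omega
  · intro u hu
    have h := (TrueLinks.iterate_sweep hw (Nat.log 2 (maxDegree n G₁ G₂)) k h0).2
    exact ⟨fun hm => hu (h _ hm).1.symm, fun hm => hu (h _ hm).1⟩

end Matching

/-! ### Sampling the edges and the seeds -/

/-- The law of independent Bernoulli choices. -/
noncomputable def choices (κ : Type*) [Fintype κ] (p : unitInterval) : Measure (κ → Bool) :=
  Measure.pi fun _ => bernoulliMeasure true false p

instance (κ : Type*) [Fintype κ] (p : unitInterval) : IsProbabilityMeasure (choices κ p) := by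
  unfold choices
  infer_instance

theorem lintegral_choices_prod {κ ι : Type*} [Fintype κ] [Fintype ι] (p : unitInterval)
    {e : ι → κ} (he : Function.Injective e) (h : ι → Bool → ENNReal) :
    ∫⁻ b, ∏ i, h i (b (e i)) ∂(choices κ p) =
      ∏ i, ∫⁻ x, h i x ∂(bernoulliMeasure true false p) := by
  have h1 : iIndepFun (fun (j : κ) (b : κ → Bool) => b j) (choices κ p) :=
    iIndepFun_pi (X := fun (_ : κ) (x : Bool) => x) fun _ => aemeasurable_id
  have h2 := (h1.precomp he).comp (fun i => h i) fun i => measurable_of_countable _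
  have h3 := lintegral_prod_eq_prod_lintegral_of_indepFun Finset.univ _ h2
    fun i => measurable_of_countable _
  refine h3.trans (Finset.prod_congr rfl fun i _ => ?_)
  exact (measurePreserving_eval (fun _ : κ => bernoulliMeasure true false p) (e i)).lintegral_comp
    (measurable_of_countable (h i))

theorem lintegral_bernoulli_ite (p : unitInterval) {α : ℝ} (hα : 0 ≤ α) :
    ∫⁻ x : Bool, (if x = true then ENNReal.ofReal α else 1) ∂(bernoulliMeasure true false p) =
      ENNReal.ofReal (1 - p * (1 - α)) := by
  have hp := p.2.1
  have hp' := p.2.2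
  rw [bernoulliMeasure_def, lintegral_add_measure, lintegral_smul_measure,
    lintegral_smul_measure, lintegral_dirac, lintegral_dirac]
  have h1 : ((unitInterval.toNNReal p : NNReal) : ENNReal) = ENNReal.ofReal p := by
    rw [ENNReal.ofReal, Real.toNNReal_of_nonneg hp]
    rfl
  have h2 : ((unitInterval.toNNReal (unitInterval.symm p) : NNReal) : ENNReal) =
      ENNReal.ofReal (1 - p) := by
    rw [ENNReal.ofReal, Real.toNNReal_of_nonneg (by linarith)]
    rfl
  simp only [if_true, Bool.false_eq_true, if_false, ENNReal.smul_def, smul_eq_mul, h1, h2, mul_one]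
  rw [← ENNReal.ofReal_mul hp, ← ENNReal.ofReal_add (by positivity) (by linarith)]
  congr 1
  ring

theorem lintegral_choices_ite {κ ι : Type*} [Fintype κ] [Fintype ι] (p : unitInterval)
    {e : ι → κ} (he : Function.Injective e) (P : ι → Prop) [DecidablePred P] {α : ℝ}
    (hα : 0 ≤ α) :
    ∫⁻ b, ∏ i, (if P i ∧ b (e i) = true then ENNReal.ofReal α else 1) ∂(choices κ p) =
      ∏ i, (if P i then ENNReal.ofReal (1 - p * (1 - α)) else 1) := by
  rw [lintegral_choices_prod p he fun i x => if P i ∧ x = true then ENNReal.ofReal α else 1]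
  refine Finset.prod_congr rfl fun i _ => ?_
  by_cases hP : P i
  · simp only [hP, true_and, if_true]
    exact lintegral_bernoulli_ite p hα
  · simp [hP]

/-- The law of the choices of the two copies and of the seeds. -/
noncomputable def samples (N n : ℕ) (s l : unitInterval) :
    Measure ((Fin N → Bool) × (Fin N → Bool) × (Fin n → Bool)) :=
  (choices (Fin N) s).prod ((choices (Fin N) s).prod (choices (Fin n) l))

instance (N n : ℕ) (s l : unitInterval) : IsProbabilityMeasure (samples N n s l) := by
  unfold samples
  infer_instance

/-- Integrating out the seeds, the second copy and the first copy in turn replaces a weight α by 1 -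
p(1 - α) with p = l, s, s. This is the generating function of independent Bernoulli variables of
parameter s²l; injectivity of `e` and `a` gives the independence. -/
theorem lintegral_samples_prod {N n : ℕ} (s l : unitInterval) {ι : Type*} [Fintype ι]
    {e : ι → Fin N} (he : Function.Injective e) {a : ι → Fin n} (ha : Function.Injective a)
    {q : ℝ} (hq : 0 ≤ q) :
    ∫⁻ x, ∏ i, (if (x.1 (e i) = true ∧ x.2.1 (e i) = true) ∧ x.2.2 (a i) = true
        then ENNReal.ofReal q else 1) ∂(samples N n s l) =
      ENNReal.ofReal (1 - (s : ℝ) ^ 2 * l * (1 - q)) ^ Fintype.card ι := by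
  have hs := s.2.1
  have hs' := s.2.2
  have hl := l.2.1
  have hl' := l.2.2
  have h1 : 0 ≤ 1 - (l : ℝ) * (1 - q) := by nlinarith
  have h2 : 0 ≤ 1 - (s : ℝ) * (1 - (1 - l * (1 - q))) := by nlinarith
  rw [samples, lintegral_prod _ (measurable_of_countable _).aemeasurable]
  calc _ = ∫⁻ b₁, ∫⁻ b₂, ∫⁻ c, ∏ i, (if (b₁ (e i) = true ∧ b₂ (e i) = true) ∧ c (a i) = true
        then ENNReal.ofReal q else 1) ∂(choices (Fin n) l) ∂(choices (Fin N) s)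
          ∂(choices (Fin N) s) := by
        refine lintegral_congr fun b₁ => ?_
        rw [lintegral_prod _ (measurable_of_countable _).aemeasurable]
    _ = ∫⁻ b₁, ∫⁻ b₂, ∏ i, (if b₁ (e i) = true ∧ b₂ (e i) = true
        then ENNReal.ofReal (1 - l * (1 - q)) else 1) ∂(choices (Fin N) s)
          ∂(choices (Fin N) s) := by
        refine lintegral_congr fun b₁ => lintegral_congr fun b₂ => ?_
        exact lintegral_choices_ite l ha (fun i => b₁ (e i) = true ∧ b₂ (e i) = true) hq
    _ = ∫⁻ b₁, ∏ i, (if True ∧ b₁ (e i) = true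
        then ENNReal.ofReal (1 - s * (1 - (1 - l * (1 - q)))) else 1) ∂(choices (Fin N) s) := by
        refine lintegral_congr fun b₁ => ?_
        rw [lintegral_choices_ite s he (fun i => b₁ (e i) = true) h1]
        simp only [true_and]
    _ = _ := by
        rw [lintegral_choices_ite s he (fun _ => True) h2]
        simp only [if_true, Finset.prod_const, Finset.card_univ]
        congr 2
        ring

/-- A lower tail bound for the number of edges kept in both copies whose node is a seed. -/
theorem samples_card_lt_le {N n : ℕ} (s l : unitInterval) {ι : Type*} [Fintype ι]
    {e : ι → Fin N} (he : Function.Injective e) {a : ι → Fin n} (ha : Function.Injective a)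
    {d : ℝ} (hd : 31 / 32 * d ≤ Fintype.card ι) :
    samples N n s l {x | ((univ.filter fun i => (x.1 (e i) = true ∧ x.2.1 (e i) = true) ∧
        x.2.2 (a i) = true).card : ℝ) < 7 / 8 * d * (s : ℝ) ^ 2 * l} ≤
      ENNReal.ofReal (Real.exp (-(d * (s : ℝ) ^ 2 * l) / 436)) := by
  have hs := s.2.1
  have hs' := s.2.2
  have hl := l.2.1
  have hl' := l.2.2
  set p : ℝ := (s : ℝ) ^ 2 * l with hp
  have hp0 : 0 ≤ p := by positivity
  have hp1 : p ≤ 1 := mul_le_one₀ (pow_le_one₀ hs hs') hl hl'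
  -- Chernoff parameter 1/16: then 1 - q ≥ 1/17, and the exponent 31/(32·17) - 7/(8·16) = 5/2176 is
  -- just above 1/436.
  set q : ℝ := Real.exp (-(1 / 16)) with hq
  have hq0 : 0 < q := Real.exp_pos _
  have hq1 : q ≤ 16 / 17 := by
    have h := Real.add_one_le_exp (1 / 16 : ℝ)
    have h' : q * Real.exp (1 / 16) = 1 := by
      rw [hq, ← Real.exp_add]
      norm_num
    nlinarith
  let z : (Fin N → Bool) × (Fin N → Bool) × (Fin n → Bool) → ENNReal := fun x =>
    ∏ i, (if (x.1 (e i) = true ∧ x.2.1 (e i) = true) ∧ x.2.2 (a i) = true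
        then ENNReal.ofReal q else 1)
  have hz : ∀ x, z x = ENNReal.ofReal (Real.exp (-(1 / 16) *
      ((univ.filter fun i => (x.1 (e i) = true ∧ x.2.1 (e i) = true) ∧
        x.2.2 (a i) = true).card : ℝ))) := by
    intro x
    simp only [z]
    rw [Finset.prod_ite, Finset.prod_const, Finset.prod_const_one, mul_one, mul_comm, Real.exp_nat_mul,
      ENNReal.ofReal_pow (Real.exp_pos _).le]
  set t : ℝ := Real.exp (-(1 / 16) * (7 / 8 * d * p)) with ht
  have hsub : {x : (Fin N → Bool) × (Fin N → Bool) × (Fin n → Bool) |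
      ((univ.filter fun i => (x.1 (e i) = true ∧ x.2.1 (e i) = true) ∧
        x.2.2 (a i) = true).card : ℝ) < 7 / 8 * d * (s : ℝ) ^ 2 * l} ⊆
      {x | ENNReal.ofReal t ≤ z x} := by
    intro x hx
    simp only [Set.mem_ofPred_eq] at hx ⊢
    rw [hz]
    apply ENNReal.ofReal_le_ofReal
    apply Real.exp_le_exp.2
    have : 7 / 8 * d * p = 7 / 8 * d * (s : ℝ) ^ 2 * l := by rw [hp]; ring
    rw [this]
    linarith
  refine (measure_mono hsub).trans ?_
  have hmarkov := mul_meas_ge_le_lintegral (μ := samples N n s l) (measurable_of_countable z)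
    (ENNReal.ofReal t)
  rw [lintegral_samples_prod s l he ha hq0.le] at hmarkov
  have ht0 : 0 < t := Real.exp_pos _
  rw [mul_comm, ← ENNReal.le_div_iff_mul_le (Or.inl (by simpa using ht0))
    (Or.inl ENNReal.ofReal_ne_top)] at hmarkov
  refine hmarkov.trans ?_
  rw [← ENNReal.ofReal_pow (by nlinarith), ← ENNReal.ofReal_div_of_pos ht0]
  apply ENNReal.ofReal_le_ofReal
  rw [div_le_iff₀ ht0, ht, ← Real.exp_add]
  have h1 : 1 - p * (1 - q) ≤ Real.exp (-(p / 17)) := by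
    have := Real.add_one_le_exp (-(p / 17))
    nlinarith
  calc (1 - p * (1 - q)) ^ Fintype.card ι ≤ Real.exp (-(p / 17)) ^ Fintype.card ι :=
        pow_le_pow_left₀ (by nlinarith) h1 _
    _ = Real.exp (Fintype.card ι * (-(p / 17))) := by rw [Real.exp_nat_mul]
    _ ≤ _ := by
        apply Real.exp_le_exp.2
        have h2 : p * (31 / 32 * d) ≤ p * Fintype.card ι := mul_le_mul_of_nonneg_left hd hp0
        have h3 : 0 ≤ p * Fintype.card ι := by positivity
        have h4 : d * (s : ℝ) ^ 2 * l = p * d := by rw [hp]; ring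
        rw [h4]
        nlinarith

/-- The seeds determined by the choices `c`. -/
def seedsOf {n : ℕ} (c : Fin n → Bool) : Finset (ℕ × ℕ) :=
  ((Finset.univ : Finset (Fin n)).filter fun v : Fin n => c v = true).image
    fun v : Fin n => ((v : ℕ), (v : ℕ))

/-- A node with many senders has many first-phase witnesses. -/
theorem samples_score_lt_le {m n : ℕ} (s l : unitInterval) (f : Fin (n * m) → ℕ) (v : ℕ)
    {d : ℝ} (hd : 31 / 32 * d ≤ (senders m n f v).card) :
    samples (n * m) n s l {x | (score (survivors m f x.1) (survivors m f x.2.1) (seedsOf x.2.2) v v : ℝ)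
        < 7 / 8 * d * (s : ℝ) ^ 2 * l} ≤
      ENNReal.ofReal (Real.exp (-(d * (s : ℝ) ^ 2 * l) / 436)) := by
  classical
  have hsend : ∀ i : senders m n f v, ∃ e : Fin (n * m), (e : ℕ) / m = i ∧ f e = v := fun i => by
    have := i.2
    simp only [senders, Finset.mem_filter] at this
    exact this.2.2
  choose e he1 he2 using hsend
  have hlt : ∀ i : senders m n f v, (i : ℕ) < n := fun i => by
    have := i.2
    simp only [senders, Finset.mem_filter, Finset.mem_range] at this
    exact this.1
  let a : senders m n f v → Fin n := fun i => ⟨i, hlt i⟩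
  have he : Function.Injective e := fun i j hij => Subtype.ext (by rw [← he1 i, ← he1 j, hij])
  have ha : Function.Injective a := fun i j hij => Subtype.ext (congrArg Fin.val hij)
  refine (measure_mono fun x hx => ?_).trans
    (samples_card_lt_le s l he ha (d := d) (by simpa using hd))
  simp only [Set.mem_ofPred_eq] at hx ⊢
  refine lt_of_le_of_lt ?_ hx
  rw [Nat.cast_le]
  refine Finset.card_le_card_of_injOn (fun i => ((i : ℕ), (i : ℕ))) (fun i hi => ?_)
    (fun i _ j _ hij => Subtype.ext (congrArg Prod.fst hij))
  simp only [Finset.coe_filter, Finset.mem_univ, true_and, Set.mem_ofPred_eq] at hi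
  simp only [Finset.coe_filter, Set.mem_ofPred_eq, seedsOf, Finset.mem_image, Finset.mem_filter,
    Finset.mem_univ, true_and, adj_survivors_iff]
  exact ⟨⟨a i, hi.2, rfl⟩, ⟨e i, hi.1.1, Or.inl ⟨he1 i, he2 i⟩⟩,
    ⟨e i, hi.1.2, Or.inl ⟨he1 i, he2 i⟩⟩⟩

/-! ### Degrees in the copies -/

/-- The contribution of the edge number `e` to the degree of `v`. -/
def incidence (m : ℕ) {k : ℕ} (f : Fin k → ℕ) (v : ℕ) (e : Fin k) : ℕ :=
  (if (e : ℕ) / m = v then 1 else 0) + if f e = v then 1 else 0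

theorem degree_graphOf_eq_sum {m k : ℕ} (f : Fin k → ℕ) (v : ℕ) :
    degree (graphOf m f) v = ∑ e, incidence m f v e := by
  rw [degree_graphOf, outs, hits, ← Finset.sum_add_distrib]
  rfl

theorem degree_survivors {m k : ℕ} (f : Fin k → ℕ) (β : Fin k → Bool) (v : ℕ) :
    degree (survivors m f β) v = ∑ e, if β e = true then incidence m f v e else 0 := by
  rw [← Finset.sum_filter]
  simp only [incidence, Finset.sum_add_distrib]
  rw [← Finset.card_filter, ← Finset.card_filter]
  simp only [degree, endpoints, survivors, Multiset.map_map, Multiset.count_add,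
    Multiset.count_map, Function.comp_def]
  congr 1
  · simp only [Finset.card, Finset.filter, eq_comm]
  · simp only [Finset.card, Finset.filter, eq_comm]

/-- Chebyshev's inequality for a sum of independent terms. An edge has incidence at most 2, so its
square is at most twice the incidence, and the variance is at most twice the degree. -/
theorem choices_degree_le {m k : ℕ} (s : unitInterval) (f : Fin k → ℕ) (v : ℕ) {c : ℝ}
    (hc : 0 < c) :
    choices (Fin k) s {β | c ≤ |(degree (survivors m f β) v : ℝ) -
        s * degree (graphOf m f) v|} ≤
      ENNReal.ofReal (2 / c ^ 2) * degree (graphOf m f) v := by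
  let X : Fin k → Bool → ℝ := fun e x => if x = true then (incidence m f v e : ℝ) else 0
  have hX : ∀ e, MemLp (X e) 2 (bernoulliMeasure true false s) := fun e =>
    MemLp.of_bound (measurable_of_countable _).aestronglyMeasurable (incidence m f v e)
      (Eventually.of_forall fun x => by cases x <;> simp [X])
  have hdeg : (fun β : Fin k → Bool => (degree (survivors m f β) v : ℝ)) =
      ∑ e, fun β : Fin k → Bool => X e (β e) := by
    funext β
    rw [degree_survivors, Finset.sum_apply]
    push_cast
    rfl
  have hmean : ∫ β, (degree (survivors m f β) v : ℝ) ∂(choices (Fin k) s) =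
      s * degree (graphOf m f) v := by
    have h1 : ∀ β : Fin k → Bool, (degree (survivors m f β) v : ℝ) = ∑ e, X e (β e) := fun β => by
      have := congrFun hdeg β
      simpa using this
    simp only [h1]
    rw [integral_finsetSum]
    · have h2 : ∀ e, ∫ β, X e (β e) ∂(choices (Fin k) s) = s * incidence m f v e := fun e => by
        have h3 := integral_comp_eval (μ := fun _ : Fin k => bernoulliMeasure true false s) (i := e)
          (f := X e) (measurable_of_countable _).aestronglyMeasurable
        refine h3.trans ?_
        rw [integral_bernoulliMeasure]
        simp [X]
      simp only [h2]
      rw [← Finset.mul_sum, degree_graphOf_eq_sum]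
      push_cast
      rfl
    · intro e _
      have : Finite (Fin k → Bool) := inferInstance
      exact Integrable.of_finite
  have hvar : Var[fun β : Fin k → Bool => (degree (survivors m f β) v : ℝ); choices (Fin k) s] ≤
      2 * degree (graphOf m f) v := by
    rw [hdeg, choices, variance_sum_pi hX, degree_graphOf_eq_sum, Nat.cast_sum, Finset.mul_sum]
    refine Finset.sum_le_sum fun e _ => ?_
    refine (variance_le_expectation_sq (hX e).aestronglyMeasurable).trans ?_
    rw [integral_bernoulliMeasure]
    have h1 : (incidence m f v e : ℝ) ^ 2 ≤ 2 * incidence m f v e := by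
      have h2 : incidence m f v e ≤ 2 := by
        unfold incidence
        split_ifs <;> omega
      have h3 : (incidence m f v e : ℝ) ≤ 2 := by exact_mod_cast h2
      have h4 : (0 : ℝ) ≤ incidence m f v e := by positivity
      nlinarith
    have hs := s.2.1
    have hs' := s.2.2
    have h5 : (0 : ℝ) ≤ (incidence m f v e : ℝ) ^ 2 := by positivity
    simp [X]
    nlinarith
  have hL2 : MemLp (fun β : Fin k → Bool => (degree (survivors m f β) v : ℝ)) 2
      (choices (Fin k) s) := by
    refine MemLp.of_bound (measurable_of_countable _).aestronglyMeasurable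
      (degree (graphOf m f) v : ℝ) (Eventually.of_forall fun β => ?_)
    rw [Real.norm_natCast, Nat.cast_le, degree_survivors, degree_graphOf_eq_sum]
    exact Finset.sum_le_sum fun e _ => by split_ifs <;> omega
  have h := meas_ge_le_variance_div_sq hL2 hc
  rw [hmean] at h
  refine h.trans ?_
  rw [← ENNReal.ofReal_natCast, ← ENNReal.ofReal_mul (by positivity)]
  apply ENNReal.ofReal_le_ofReal
  rw [div_mul_eq_mul_div]
  gcongr

/-! ### Events under the law of the model -/

/-- Conditions on the underlying graph; outcomes form a countable space, so every event is
measurable. -/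
theorem law_le_ev {m n : ℕ} {s l : unitInterval} {B : Set (Outcome m n)}
    {c : (Fin (n * m) → ℕ) → ENNReal}
    (h : ∀ f, paTargets m (n * m) f ≠ 0 → samples (n * m) n s l {x | (f, x) ∈ B} ≤ c f) :
    law m n s l B ≤ ev m (n * m) c := by
  have h1 : law m n s l = (paTargets m (n * m)).toMeasure.prod (samples (n * m) n s l) := rfl
  rw [h1, Measure.prod_apply B.to_countable.measurableSet, lintegral_countable']
  refine ENNReal.tsum_le_tsum fun f => ?_
  rw [PMF.toMeasure_apply_singleton _ _ (measurableSet_singleton f), mul_comm]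
  by_cases hf : paTargets m (n * m) f = 0
  · simp [hf]
  · exact mul_le_mul_right (h f hf) _

theorem law_graph_le {m n : ℕ} (s l : unitInterval) (P : (Fin (n * m) → ℕ) → Prop)
    [DecidablePred P] :
    law m n s l {ω | P ω.1} ≤ ev m (n * m) fun f => if P f then 1 else 0 := by
  refine law_le_ev fun f _ => ?_
  split_ifs with hP
  · exact prob_le_one
  · simp [hP]

instance (m n : ℕ) (s l : unitInterval) : IsProbabilityMeasure (law m n s l) := by
  have h1 : law m n s l = (paTargets m (n * m)).toMeasure.prod (samples (n * m) n s l) := rfl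
  rw [h1]
  infer_instance

/-! ### The conclusion on a good event -/

theorem degree_survivors_le {m k : ℕ} (f : Fin k → ℕ) (β : Fin k → Bool) (v : ℕ) :
    degree (survivors m f β) v ≤ degree (graphOf m f) v := by
  rw [degree_survivors, degree_graphOf_eq_sum]
  exact Finset.sum_le_sum fun e _ => by split_ifs <;> omega

theorem degree_graphOf_le {m k : ℕ} (f : Fin k → ℕ) (v : ℕ) :
    degree (graphOf m f) v ≤ 2 * k := by
  refine (Multiset.count_le_card _ _).trans (le_of_eq ?_)
  rw [card_endpoints, card_graphOf]

theorem mem_seedsOf {n : ℕ} {c : Fin n → Bool} {p : ℕ × ℕ} (hp : p ∈ seedsOf c) :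
    p.1 = p.2 ∧ p.1 < n := by
  simp only [seedsOf, Finset.mem_image] at hp
  obtain ⟨i, -, rfl⟩ := hp
  exact ⟨rfl, i.2⟩

/-- The properties of the outcome which make User-Matching succeed. -/
structure Good {m n : ℕ} (s l : unitInterval) (U : ℕ) (y D Δ thr : ℝ) (ω : Outcome m n) :
    Prop where
  source : ∀ e, ω.1 e ≤ e / m
  shared_late : ∀ u < n, ∀ v < n, (U ≤ u ∨ U ≤ v) → (shared m n ω.1 u v).card ≤ 3
  shared_early : ∀ u < n, ∀ v < n, u < U → v < U → ((shared m n ω.1 u v).card : ℝ) ≤ y + 3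
  degree_early : ∀ v < n, v < U → D ≤ degree (graph ω) v
  degree_copy₁ : ∀ v < n, v < U → |(degree (copy₁ ω) v : ℝ) - s * degree (graph ω) v| < Δ
  degree_copy₂ : ∀ v < n, v < U → |(degree (copy₂ ω) v : ℝ) - s * degree (graph ω) v| < Δ
  degree_pow : ∀ v < n, v < U → ∀ j, 2 ^ j ≤ 2 * (n * m) →
    Δ ≤ |(2 : ℝ) ^ j - s * degree (graph ω) v|
  witnesses : ∀ v < n, thr ≤ degree (graph ω) v →
    31 / 32 * (degree (graph ω) v : ℝ) ≤ (senders m n ω.1 v).card →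
    7 / 8 * (degree (graph ω) v : ℝ) * (s : ℝ) ^ 2 * l ≤
      score (copy₁ ω) (copy₂ ω) (seeds ω) v v

/-- `hmw` and `hyD` make the 2m plus multiple-edge correction at most 1/32 of the degree, for late
and early nodes respectively. `hTw` places the witness bound above `T`, `hyD'` separates true pairs
from wrong pairs of early nodes, and `hwD` makes every early node subject to the witness bound. -/
theorem Good.conclusion {m n : ℕ} (hm : 1 ≤ m) {s l : unitInterval} (hs : 0 < s) (hl : 0 < l)
    {T k : ℕ} (hT : 9 ≤ T) (hk : 1 ≤ k) {U : ℕ} {y D Δ w : ℝ} {ω : Outcome m n}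
    (hω : Good s l U y D Δ (4 * w / ((s : ℝ) ^ 2 * l)) ω)
    (hmw : 40 * m ≤ w) (hTw : T ≤ 7 / 2 * w)
    (hyD : 32 * (5 * m + m * y) ≤ D) (hyD' : y + 5 < 7 / 8 * D * (s : ℝ) ^ 2 * l)
    (hwD : 4 * w / ((s : ℝ) ^ 2 * l) ≤ D) (v : ℕ) (hv : v < n)
    (hdv : 4 * w / ((s : ℝ) ^ 2 * l) ≤ (degree (graph ω) v : ℝ)) :
    (7 / 8 * (degree (graph ω) v : ℝ) * (s : ℝ) ^ 2 * l ≤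
      (score (copy₁ ω) (copy₂ ω) (seeds ω) v v : ℝ)) ∧
    (∀ u < n, u ≠ v →
      (score (copy₁ ω) (copy₂ ω) (seeds ω) v u : ℝ) <
        7 / 8 * (degree (graph ω) v : ℝ) * (s : ℝ) ^ 2 * l ∧
      (score (copy₁ ω) (copy₂ ω) (seeds ω) u v : ℝ) <
        7 / 8 * (degree (graph ω) v : ℝ) * (s : ℝ) ^ 2 * l) ∧
    (v, v) ∈ userMatching n (copy₁ ω) (copy₂ ω) (seeds ω) T k ∧
    ∀ u < n, u ≠ v →
      (v, u) ∉ userMatching n (copy₁ ω) (copy₂ ω) (seeds ω) T k ∧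
      (u, v) ∉ userMatching n (copy₁ ω) (copy₂ ω) (seeds ω) T k := by
  have hs0 : (0 : ℝ) < s := hs
  have hl0 : (0 : ℝ) < l := hl
  have hp0 : 0 < (s : ℝ) ^ 2 * l := by positivity
  have hp1 : (s : ℝ) ^ 2 * l ≤ 1 := mul_le_one₀ (pow_le_one₀ s.2.1 s.2.2) l.2.1 l.2.2
  have hm1 : (1 : ℝ) ≤ m := by exact_mod_cast hm
  have hL : ∀ p ∈ seeds ω, p.1 = p.2 ∧ p.1 < n := fun p hp => mem_seedsOf (c := ω.2.2.2) hp
  have hmul : ∀ v, 4 * w / ((s : ℝ) ^ 2 * l) ≤ (degree (graph ω) v : ℝ) →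
      4 * w ≤ (degree (graph ω) v : ℝ) * (s : ℝ) ^ 2 * l := fun v h => by
    rw [div_le_iff₀ hp0, ← mul_assoc] at h
    exact h
  -- many witnesses for the true pair
  have hscore : ∀ v < n, 4 * w / ((s : ℝ) ^ 2 * l) ≤ (degree (graph ω) v : ℝ) →
      7 / 8 * (degree (graph ω) v : ℝ) * (s : ℝ) ^ 2 * l ≤
        (score (copy₁ ω) (copy₂ ω) (seeds ω) v v : ℝ) := by
    intro v hv hdv
    refine hω.witnesses v hv hdv ?_
    have h1 : (degree (graph ω) v : ℝ) ≤ 2 * m + (senders m n ω.1 v).card +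
        m * (shared m n ω.1 v v).card := by
      exact_mod_cast degree_le_card_senders hm hω.source v
    have h2 : 4 * w ≤ (degree (graph ω) v : ℝ) := by
      refine le_trans ?_ hdv
      rw [le_div_iff₀ hp0]
      nlinarith
    rcases Nat.lt_or_ge v U with hvU | hvU
    · have h3 := hω.shared_early v hv v hv hvU hvU
      have h4 := hω.degree_early v hv hvU
      nlinarith
    · have h3 : ((shared m n ω.1 v v).card : ℝ) ≤ 3 := by
        exact_mod_cast hω.shared_late v hv v hv (Or.inl hvU)
      nlinarith
  -- few common neighbours of different nodes
  have hcommon : ∀ u < n, ∀ v < n, u ≠ v →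
      common n (copy₁ ω) (copy₂ ω) u v ≤ (shared m n ω.1 u v).card + 2 := fun u _ v _ huv =>
    card_common_le hω.source _ _ huv
  have hfew : ∀ v < n, 4 * w / ((s : ℝ) ^ 2 * l) ≤ (degree (graph ω) v : ℝ) → ∀ u < n, u ≠ v →
      (common n (copy₁ ω) (copy₂ ω) v u : ℝ) <
        7 / 8 * (degree (graph ω) v : ℝ) * (s : ℝ) ^ 2 * l ∧
      (common n (copy₁ ω) (copy₂ ω) u v : ℝ) <
        7 / 8 * (degree (graph ω) v : ℝ) * (s : ℝ) ^ 2 * l := by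
    intro v hv hdv u hu huv
    have h1 := hmul v hdv
    have h2 : (common n (copy₁ ω) (copy₂ ω) v u : ℝ) ≤ (shared m n ω.1 v u).card + 2 := by
      exact_mod_cast hcommon v hv u hu huv.symm
    have h3 : (common n (copy₁ ω) (copy₂ ω) u v : ℝ) ≤ (shared m n ω.1 u v).card + 2 := by
      exact_mod_cast hcommon u hu v hv huv
    by_cases hU : U ≤ u ∨ U ≤ v
    · have h4 : ((shared m n ω.1 v u).card : ℝ) ≤ 3 := by
        exact_mod_cast hω.shared_late v hv u hu hU.symm
      have h5 : ((shared m n ω.1 u v).card : ℝ) ≤ 3 := by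
        exact_mod_cast hω.shared_late u hu v hv hU
      constructor <;> linarith
    · push Not at hU
      have h4 := hω.shared_early v hv u hu hU.2 hU.1
      have h5 := hω.shared_early u hu v hv hU.1 hU.2
      have h6 := hω.degree_early v hv hU.2
      have h7 : 7 / 8 * D * (s : ℝ) ^ 2 * l ≤
          7 / 8 * (degree (graph ω) v : ℝ) * (s : ℝ) ^ 2 * l := by gcongr
      constructor <;> linarith
  have hw' : ∀ u < n, ∀ v < n, u ≠ v → T ≤ common n (copy₁ ω) (copy₂ ω) u v →
      common n (copy₁ ω) (copy₂ ω) u v < score (copy₁ ω) (copy₂ ω) (seeds ω) v v ∧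
        ∀ j, 2 ^ j ≤ degree (copy₂ ω) v → 2 ^ j ≤ degree (copy₁ ω) v := by
    intro u hu v hv huv hTc
    have h1 := hcommon u hu v hv huv
    -- A pair with a late node has at most 3 + 2 common neighbours, fewer than `T`.
    have hU : ¬(U ≤ u ∨ U ≤ v) := fun h => by
      have := hω.shared_late u hu v hv h
      omega
    push Not at hU
    have hdv := hwD.trans (hω.degree_early v hv hU.2)
    refine ⟨?_, fun j hj => ?_⟩
    · exact_mod_cast (hfew v hv hdv u hu huv).2.trans_le (hscore v hv hdv)
    · by_contra hj'
      push Not at hj'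
      have h2 := hω.degree_copy₁ v hv hU.2
      have h3 := hω.degree_copy₂ v hv hU.2
      have h4 := hω.degree_pow v hv hU.2 j
        (hj.trans ((degree_survivors_le _ _ _).trans (degree_graphOf_le _ _)))
      have h5 : (degree (copy₁ ω) v : ℝ) < 2 ^ j := by exact_mod_cast hj'
      have h6 : (2 : ℝ) ^ j ≤ degree (copy₂ ω) v := by exact_mod_cast hj
      rw [abs_lt] at h2 h3
      refine absurd h4 (not_le.2 (abs_lt.2 ⟨?_, ?_⟩)) <;> linarith
  have hsv := hscore v hv hdv
  have hTv : T ≤ score (copy₁ ω) (copy₂ ω) (seeds ω) v v := by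
    have := hmul v hdv
    have h : (T : ℝ) ≤ score (copy₁ ω) (copy₂ ω) (seeds ω) v v := by linarith
    exact_mod_cast h
  have hcorrect := userMatching_correct hv (by omega) hk hL hw' hTv fun u hu huv => by
    have h := hfew v hv hdv u hu huv
    exact ⟨by exact_mod_cast h.1.trans_le hsv, by exact_mod_cast h.2.trans_le hsv⟩
  refine ⟨hsv, fun u hu huv => ?_, hcorrect.1, fun u _ huv => hcorrect.2 u huv⟩
  have h := hfew v hv hdv u hu huv
  exact ⟨lt_of_le_of_lt (Nat.cast_le.2 (score_le_common hL _ _ _ _)) h.1,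
    lt_of_le_of_lt (Nat.cast_le.2 (score_le_common hL _ _ _ _)) h.2⟩

/-! ### Probabilities of the bad events -/

section Bad

variable {m n : ℕ} (s l : unitInterval)

theorem law_source_eq_zero : law m n s l {ω | ¬∀ e, ω.1 e ≤ e / m} = 0 := by
  classical
  refine le_antisymm ((law_graph_le s l fun f => ¬∀ e, f e ≤ e / m).trans (le_of_eq ?_)) zero_le
  rw [ev, ENNReal.tsum_eq_zero]
  intro f
  by_cases hf : paTargets m (n * m) f = 0
  · simp [hf]
  · rw [if_neg (not_not.2 (le_source_of_paTargets_ne_zero f hf)), mul_zero]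

/-- The constant in the bound on the fourth factorial moment of the number of shared nodes. -/
def sharedConst (m : ℕ) : ℝ := 16 * (m : ℝ) ^ 8 * (m + 8 : ℝ) ^ 8

theorem sharedConst_nonneg (m : ℕ) : 0 ≤ sharedConst m := by
  unfold sharedConst
  positivity

theorem ev_shared_le (hm : 1 ≤ m) {u v : ℕ} (hu : u < n) (hv : v < n) :
    ev m (n * m) (fun f => ((shared m n f u v).card.descFactorial 4 : ENNReal)) ≤
      ENNReal.ofReal (sharedConst m * (1 + Real.log n) ^ 4 *
        (1 / ((u : ℝ) + 1) ^ 2 * (1 / ((v : ℝ) + 1) ^ 2))) := by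
  refine (ev_descFactorial_shared_le hm hu hv 4).trans (ENNReal.ofReal_le_ofReal ?_)
  have h0 : (0 : ℝ) ≤ (harmonic n : ℝ) := by
    rw [harmonic]
    push_cast
    positivity
  have h1 := harmonic_le_one_add_log n
  have h2 : √(((u : ℝ) + 1) * (v + 1)) ^ 4 = ((u : ℝ) + 1) ^ 2 * (v + 1) ^ 2 := by
    rw [show (4 : ℕ) = 2 * 2 from rfl, pow_mul, Real.sq_sqrt (by positivity), mul_pow]
  rw [div_pow, h2, mul_pow]
  have h3 : (harmonic n : ℝ) ^ 4 ≤ (1 + Real.log n) ^ 4 := by gcongr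
  have h4 : (m : ℝ) ^ (4 * 2) * (m + (4 : ℕ) * 2 : ℝ) ^ (4 * 2) * (2 ^ 4 * (harmonic n : ℝ) ^ 4 /
      (((u : ℝ) + 1) ^ 2 * (v + 1) ^ 2)) = sharedConst m * (harmonic n : ℝ) ^ 4 *
        (1 / ((u : ℝ) + 1) ^ 2 * (1 / ((v : ℝ) + 1) ^ 2)) := by
    unfold sharedConst
    push_cast
    norm_num
    field_simp
  rw [h4]
  have := sharedConst_nonneg m
  gcongr

theorem sum_inv_sq_le {U : ℕ} (hU : 1 ≤ U) (n : ℕ) :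
    ∑ v ∈ range n, (if U ≤ v then (1 : ℝ) / ((v : ℝ) + 1) ^ 2 else 0) ≤ (1 : ℝ) / U := by
  have hU' : (1 : ℝ) ≤ U := by exact_mod_cast hU
  -- The subtracted term makes the induction telescope; the maximum with `U` covers the range where
  -- the sum is still empty.
  have h : ∑ v ∈ range n, (if U ≤ v then (1 : ℝ) / ((v : ℝ) + 1) ^ 2 else 0) ≤
      (1 : ℝ) / U - 1 / ((max n U : ℕ) : ℝ) := by
    induction n with
    | zero => simp
    | succ n ih =>
      rw [Finset.sum_range_succ]
      split_ifs with hn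
      · rw [max_eq_left hn] at ih
        rw [max_eq_left (by omega)]
        have hn' : (1 : ℝ) ≤ n := by exact_mod_cast hU.trans hn
        have h1 : 1 / ((n : ℝ) + 1) ^ 2 ≤ 1 / n - 1 / ((n + 1 : ℕ) : ℝ) := by
          push_cast
          rw [div_sub_div _ _ (by positivity) (by positivity), div_le_div_iff₀ (by positivity)
            (by positivity)]
          nlinarith
        linarith
      · rw [max_eq_right (by omega)] at ih ⊢
        linarith
  have h' : (0 : ℝ) ≤ 1 / ((max n U : ℕ) : ℝ) := by positivity
  linarith

theorem sum_inv_sq_le_two (n : ℕ) : ∑ v ∈ range n, 1 / ((v : ℝ) + 1) ^ 2 ≤ 2 := by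
  have h1 : ∀ v ∈ range n, 1 / ((v : ℝ) + 1) ^ 2 ≤
      (if 1 ≤ v then 1 / ((v : ℝ) + 1) ^ 2 else 0) + if v = 0 then 1 else 0 := by
    intro v _
    rcases Nat.eq_zero_or_pos v with rfl | h
    · simp
    · have h' : 1 ≤ v := h
      simp [h', h.ne']
  refine (Finset.sum_le_sum h1).trans ?_
  rw [Finset.sum_add_distrib, Finset.sum_ite_eq']
  have := sum_inv_sq_le le_rfl n
  have h2 : (if 0 ∈ range n then (1 : ℝ) else 0) ≤ 1 := by split_ifs <;> norm_num
  push_cast at this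
  linarith

/-- Union bound over pairs: having four shared nodes makes the fourth factorial moment's integrand
at least 1. The constant is 2 (which node is late) times 2 (the full sum of inverse squares). -/
theorem law_shared_late_le (hm : 1 ≤ m) {U : ℕ} (hU : 1 ≤ U) :
    law m n s l {ω | ¬∀ u < n, ∀ v < n, (U ≤ u ∨ U ≤ v) → (shared m n ω.1 u v).card ≤ 3} ≤
      ENNReal.ofReal (4 * sharedConst m * (1 + Real.log n) ^ 4 / U) := by
  classical
  refine (law_graph_le s l fun f => ¬∀ u < n, ∀ v < n, (U ≤ u ∨ U ≤ v) →
    (shared m n f u v).card ≤ 3).trans ?_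
  have h1 : ∀ f : Fin (n * m) → ℕ, (if ¬∀ u < n, ∀ v < n, (U ≤ u ∨ U ≤ v) →
      (shared m n f u v).card ≤ 3 then (1 : ENNReal) else 0) ≤
      ∑ p ∈ (range n ×ˢ range n).filter (fun p => U ≤ p.1 ∨ U ≤ p.2),
        ((shared m n f p.1 p.2).card.descFactorial 4 : ENNReal) := by
    intro f
    split_ifs with h
    · exact zero_le
    · push Not at h
      obtain ⟨u, hu, v, hv, hUuv, hc⟩ := h
      refine le_trans ?_ (Finset.single_le_sum (fun _ _ => zero_le)
        (Finset.mem_filter.2 ⟨Finset.mem_product.2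
          ⟨Finset.mem_range.2 hu, Finset.mem_range.2 hv⟩, hUuv⟩ : (u, v) ∈ _))
      exact_mod_cast Nat.descFactorial_pos.2 hc
  refine (ev_mono fun f _ => h1 f).trans ?_
  rw [ev_finset_sum]
  have hC := sharedConst_nonneg m
  have hlog : 0 ≤ 1 + Real.log n := by
    have := Real.log_natCast_nonneg n
    linarith
  calc _ ≤ ∑ p ∈ (range n ×ˢ range n).filter (fun p => U ≤ p.1 ∨ U ≤ p.2),
        ENNReal.ofReal (sharedConst m * (1 + Real.log n) ^ 4 *
          (1 / ((p.1 : ℝ) + 1) ^ 2 * (1 / ((p.2 : ℝ) + 1) ^ 2))) := by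
        refine Finset.sum_le_sum fun p hp => ?_
        have hp := Finset.mem_product.1 (Finset.mem_filter.1 hp).1
        exact ev_shared_le hm (Finset.mem_range.1 hp.1) (Finset.mem_range.1 hp.2)
    _ ≤ _ := by
        rw [← ENNReal.ofReal_sum_of_nonneg (fun _ _ => by positivity), ← Finset.mul_sum]
        apply ENNReal.ofReal_le_ofReal
        rw [show 4 * sharedConst m * (1 + Real.log n) ^ 4 / U =
          sharedConst m * (1 + Real.log n) ^ 4 * (4 * (1 / U)) by ring]
        refine mul_le_mul_of_nonneg_left ?_ (by positivity)
        rw [Finset.sum_filter]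
        have h2 : ∀ p ∈ range n ×ˢ range n, (if U ≤ p.1 ∨ U ≤ p.2 then
            (1 / ((p.1 : ℝ) + 1) ^ 2 * (1 / ((p.2 : ℝ) + 1) ^ 2)) else 0) ≤
            (if U ≤ p.1 then 1 / ((p.1 : ℝ) + 1) ^ 2 else 0) * (1 / ((p.2 : ℝ) + 1) ^ 2) +
            (1 / ((p.1 : ℝ) + 1) ^ 2) * (if U ≤ p.2 then 1 / ((p.2 : ℝ) + 1) ^ 2 else 0) := by
          intro p _
          have h3 : 0 ≤ 1 / ((p.1 : ℝ) + 1) ^ 2 * (1 / ((p.2 : ℝ) + 1) ^ 2) := by positivity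
          by_cases ha : U ≤ p.1 <;> by_cases hb : U ≤ p.2 <;>
            simp only [ha, hb, if_true, if_false, or_true, or_false, zero_mul, mul_zero,
              add_zero, zero_add, le_refl]
          linarith
        refine (Finset.sum_le_sum h2).trans ?_
        rw [Finset.sum_add_distrib, Finset.sum_product, Finset.sum_product]
        simp only [← Finset.mul_sum, ← Finset.sum_mul]
        have h4 := sum_inv_sq_le hU n
        have h5 := sum_inv_sq_le_two n
        have h6 : 0 ≤ ∑ v ∈ range n, 1 / ((v : ℝ) + 1) ^ 2 :=
          Finset.sum_nonneg fun _ _ => by positivity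
        have h7 : 0 ≤ ∑ v ∈ range n, (if U ≤ v then 1 / ((v : ℝ) + 1) ^ 2 else 0) :=
          Finset.sum_nonneg fun _ _ => by split_ifs <;> positivity
        nlinarith

theorem law_shared_early_le (hm : 1 ≤ m) (U : ℕ) {y : ℝ} (hy : 0 < y) :
    law m n s l {ω | ¬∀ u < n, ∀ v < n, u < U → v < U →
        ((shared m n ω.1 u v).card : ℝ) ≤ y + 3} ≤
      ENNReal.ofReal ((U : ℝ) ^ 2 * (sharedConst m * (1 + Real.log n) ^ 4 / y)) := by
  classical
  refine (law_graph_le s l fun f => ¬∀ u < n, ∀ v < n, u < U → v < U →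
        ((shared m n f u v).card : ℝ) ≤ y + 3).trans ?_
  have h1 : ∀ f : Fin (n * m) → ℕ, (if ¬∀ u < n, ∀ v < n, u < U → v < U →
      ((shared m n f u v).card : ℝ) ≤ y + 3 then (1 : ENNReal) else 0) ≤
      ∑ p ∈ (range U ×ˢ range U).filter (fun p => p.1 < n ∧ p.2 < n),
        (ENNReal.ofReal y)⁻¹ * ((shared m n f p.1 p.2).card.descFactorial 4 : ENNReal) := by
    intro f
    split_ifs with h
    · exact zero_le
    · push Not at h
      obtain ⟨u, hu, v, hv, huU, hvU, hc⟩ := h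
      refine le_trans ?_ (Finset.single_le_sum (fun _ _ => zero_le)
        (Finset.mem_filter.2 ⟨Finset.mem_product.2
          ⟨Finset.mem_range.2 huU, Finset.mem_range.2 hvU⟩, hu, hv⟩ : (u, v) ∈ _))
      have hy' : ENNReal.ofReal y ≠ 0 := by simpa using hy
      rw [← ENNReal.inv_mul_cancel hy' ENNReal.ofReal_ne_top]
      refine mul_le_mul_right ?_ _
      rw [← ENNReal.ofReal_natCast]
      apply ENNReal.ofReal_le_ofReal
      set N := (shared m n f u v).card
      have h4 : 4 ≤ N := by
        have : (3 : ℝ) < N := by linarith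
        exact_mod_cast this
      obtain ⟨M, hM⟩ := Nat.exists_eq_add_of_le' h4
      -- Keeping only the factor N - 3 > y is enough for Markov's inequality.
      have h5 : M + 1 ≤ N.descFactorial 4 := by
        rw [hM]
        simp only [Nat.descFactorial_succ, Nat.descFactorial_zero, mul_one]
        have e1 : M + 4 - 3 = M + 1 := by omega
        rw [e1]
        exact Nat.le_mul_of_pos_right _ (by
          have e2 : 0 < M + 4 - 2 := by omega
          have e3 : 0 < M + 4 - 1 := by omega
          have e4 : 0 < M + 4 - 0 := by omega
          positivity)
      have h6 : ((M : ℝ) + 1) ≤ (N.descFactorial 4 : ℝ) := by exact_mod_cast h5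
      have h7 : (N : ℝ) = M + 4 := by exact_mod_cast hM
      linarith
  refine (ev_mono fun f _ => h1 f).trans ?_
  rw [ev_finset_sum]
  have hC := sharedConst_nonneg m
  have hlog : 0 ≤ 1 + Real.log n := by
    have := Real.log_natCast_nonneg n
    linarith
  have h2 : ∀ p ∈ (range U ×ˢ range U).filter (fun p => p.1 < n ∧ p.2 < n),
      ev m (n * m) (fun f => (ENNReal.ofReal y)⁻¹ *
        ((shared m n f p.1 p.2).card.descFactorial 4 : ENNReal)) ≤
      ENNReal.ofReal (sharedConst m * (1 + Real.log n) ^ 4 / y) := by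
    intro p hp
    have hp := (Finset.mem_filter.1 hp).2
    rw [ev_const_mul, div_eq_inv_mul, ENNReal.ofReal_mul (by positivity), ENNReal.ofReal_inv_of_pos hy]
    refine mul_le_mul_right ((ev_shared_le hm hp.1 hp.2).trans (ENNReal.ofReal_le_ofReal ?_)) _
    refine mul_le_of_le_one_right (by positivity) ?_
    have h3 : ∀ z : ℕ, 1 / ((z : ℝ) + 1) ^ 2 ≤ 1 := fun z => by
      rw [div_le_one (by positivity)]
      exact one_le_pow₀ (by linarith [(Nat.cast_nonneg z : (0 : ℝ) ≤ z)])
    exact mul_le_one₀ (h3 _) (by positivity) (h3 _)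
  refine (Finset.sum_le_card_nsmul _ _ _ h2).trans ?_
  rw [nsmul_eq_mul, ENNReal.ofReal_mul (by positivity)]
  refine mul_le_mul_left ?_ _
  have h3 : ((range U ×ˢ range U).filter (fun p => p.1 < n ∧ p.2 < n)).card ≤ U ^ 2 := by
    refine (Finset.card_filter_le _ _).trans ?_
    rw [Finset.card_product, Finset.card_range, sq]
  rw [← ENNReal.ofReal_natCast]
  apply ENNReal.ofReal_le_ofReal
  exact_mod_cast h3

/-! ### Degrees of early nodes avoid small sets -/

open Classical in
theorem ev_degree_mem_le (hm : 1 ≤ m) {U v : ℕ} (hv : v < n) (hvU : v < U) (S : Finset ℕ) :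
    ev m (n * m) (fun f => if degree (graphOf m f) v ∈ S then 1 else 0) ≤
      ENNReal.ofReal (S.card * √(U / n)) := by
  have h1 : ∀ f : Fin (n * m) → ℕ, (if degree (graphOf m f) v ∈ S then (1 : ENNReal) else 0) =
      ∑ x ∈ S, if degree (graphOf m f) v = x then 1 else 0 := fun f => by
    rw [Finset.sum_ite_eq]
  simp only [h1]
  rw [ev_finset_sum]
  have h2 : ∀ x ∈ S, ev m (n * m) (fun f => if degree (graphOf m f) v = x then 1 else 0) ≤
      ENNReal.ofReal √(U / n) := fun x _ => by
    refine (ev_degree_eq_le hm v ?_ x).trans (ENNReal.ofReal_le_ofReal (Real.sqrt_le_sqrt ?_))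
    · rw [mul_comm n m]
      exact Nat.mul_le_mul_left m hv
    · have hm0 : (0 : ℝ) < m := by exact_mod_cast hm
      have hn0 : (0 : ℝ) < n := by exact_mod_cast (Nat.zero_le v).trans_lt hv
      push_cast
      rw [mul_comm (n : ℝ) m, mul_div_mul_left _ _ hm0.ne']
      gcongr
      exact_mod_cast hvU
  refine (Finset.sum_le_card_nsmul _ _ _ h2).trans (le_of_eq ?_)
  rw [nsmul_eq_mul, ENNReal.ofReal_mul (by positivity), ENNReal.ofReal_natCast]

/-- It is unlikely that the degree of an early node lies in a small set. -/
theorem law_degree_mem_le (hm : 1 ≤ m) (U : ℕ) (S : Finset ℕ) {b : ℝ} (hS : S.card ≤ b) :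
    law m n s l {ω | ∃ v < n, v < U ∧ degree (graph ω) v ∈ S} ≤
      ENNReal.ofReal (U * (b * √(U / n))) := by
  classical
  refine (law_graph_le s l fun f => ∃ v < n, v < U ∧ degree (graphOf m f) v ∈ S).trans ?_
  have h1 : ∀ f : Fin (n * m) → ℕ,
      (if ∃ v < n, v < U ∧ degree (graphOf m f) v ∈ S then (1 : ENNReal) else 0) ≤
      ∑ v ∈ (range U).filter (fun v => v < n),
        if degree (graphOf m f) v ∈ S then 1 else 0 := fun f => by
    split_ifs with h
    · obtain ⟨v, hv, hvU, hS⟩ := h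
      refine le_trans ?_ (Finset.single_le_sum (fun _ _ => zero_le)
        (Finset.mem_filter.2 ⟨Finset.mem_range.2 hvU, hv⟩))
      rw [if_pos hS]
    · exact zero_le
  refine (ev_mono fun f _ => h1 f).trans ?_
  rw [ev_finset_sum]
  refine (Finset.sum_le_card_nsmul _ _ (ENNReal.ofReal (b * √(U / n))) fun v hv => ?_).trans ?_
  · have hv := Finset.mem_filter.1 hv
    refine (ev_degree_mem_le hm hv.2 (Finset.mem_range.1 hv.1) S).trans
      (ENNReal.ofReal_le_ofReal ?_)
    gcongr
  · rw [nsmul_eq_mul, ENNReal.ofReal_mul (p := (U : ℝ)) (by positivity), ENNReal.ofReal_natCast]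
    refine mul_le_mul_left ?_ _
    exact_mod_cast (Finset.card_filter_le _ _).trans_eq (Finset.card_range U)

theorem law_degree_early_le (hm : 1 ≤ m) (U : ℕ) {D : ℝ} (hD : 0 ≤ D) :
    law m n s l {ω | ¬∀ v < n, v < U → D ≤ degree (graph ω) v} ≤
      ENNReal.ofReal (U * ((D + 1) * √(U / n))) := by
  refine (measure_mono fun ω hω => ?_).trans
    (law_degree_mem_le s l hm U (range ⌈D⌉₊) (b := D + 1) ?_)
  · simp only [Set.mem_ofPred_eq] at hω ⊢
    push Not at hω
    obtain ⟨v, hv, hvU, h⟩ := hω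
    exact ⟨v, hv, hvU, Finset.mem_range.2 (Nat.lt_ceil.2 h)⟩
  · rw [Finset.card_range]
    exact (Nat.ceil_lt_add_one hD).le

theorem card_filter_abs_lt_le {σ c Δ : ℝ} (hσ : 0 < σ) (hΔ : 0 ≤ Δ) (M : ℕ) :
    (((range M).filter fun x : ℕ => |c - σ * (x : ℝ)| < Δ).card : ℝ) ≤ 2 * Δ / σ + 1 := by
  set S := (range M).filter fun x : ℕ => |c - σ * (x : ℝ)| < Δ
  rcases S.eq_empty_or_nonempty with h | h
  · rw [h]
    simp
    positivity
  · have hmin := (Finset.mem_filter.1 (S.min'_mem h)).2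
    have hmax := (Finset.mem_filter.1 (S.max'_mem h)).2
    have hsub : S ⊆ Finset.Icc (S.min' h) (S.max' h) := fun x hx =>
      Finset.mem_Icc.2 ⟨S.min'_le x hx, S.le_max' x hx⟩
    have hcard := Finset.card_le_card hsub
    rw [Nat.card_Icc] at hcard
    have hle : S.min' h ≤ S.max' h := S.min'_le _ (S.max'_mem h)
    have h1 : (S.card : ℝ) ≤ S.max' h + 1 - S.min' h := by
      have : S.card + S.min' h ≤ S.max' h + 1 := by omega
      have : (S.card : ℝ) + S.min' h ≤ S.max' h + 1 := by exact_mod_cast this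
      linarith
    rw [abs_lt] at hmin hmax
    have h2 : ((S.max' h : ℝ) - S.min' h) ≤ 2 * Δ / σ := by
      rw [le_div_iff₀ hσ]
      nlinarith
    linarith

/-- The forbidden degrees form about log n windows around the points 2^j / s, each with at most 2Δ/s
+ 1 integers. -/
theorem law_degree_pow_le (hm : 1 ≤ m) (hs : 0 < s) (U : ℕ) {Δ : ℝ} (hΔ : 0 ≤ Δ) :
    law m n s l {ω | ¬∀ v < n, v < U → ∀ j, 2 ^ j ≤ 2 * (n * m) →
        Δ ≤ |(2 : ℝ) ^ j - s * degree (graph ω) v|} ≤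
      ENNReal.ofReal (U * (((Nat.log 2 (2 * (n * m)) + 1 : ℕ) * (2 * Δ / s + 1)) *
        √(U / n))) := by
  classical
  have hs0 : (0 : ℝ) < s := hs
  set J := Nat.log 2 (2 * (n * m)) + 1
  refine (measure_mono fun ω hω => ?_).trans
    (law_degree_mem_le s l hm U ((range J).biUnion fun j =>
      (range (2 * (n * m) + 1)).filter fun x : ℕ => |(2 : ℝ) ^ j - s * (x : ℝ)| < Δ) ?_)
  · simp only [Set.mem_ofPred_eq] at hω ⊢
    push Not at hω
    obtain ⟨v, hv, hvU, j, hj, h⟩ := hω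
    refine ⟨v, hv, hvU, Finset.mem_biUnion.2 ⟨j, Finset.mem_range.2 ?_, Finset.mem_filter.2
      ⟨Finset.mem_range.2 (Nat.lt_succ_of_le (degree_graphOf_le _ _)), h⟩⟩⟩
    exact Nat.lt_succ_of_le (Nat.le_log_of_pow_le (by norm_num) hj)
  · refine (Nat.cast_le.2 Finset.card_biUnion_le).trans ?_
    rw [Nat.cast_sum]
    refine (Finset.sum_le_card_nsmul _ _ _ fun j _ =>
      card_filter_abs_lt_le hs0 hΔ (2 * (n * m) + 1)).trans (le_of_eq ?_)
    rw [Finset.card_range, nsmul_eq_mul]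

/-! ### Degrees in the copies and witnesses -/

theorem ev_copy_le (hm : 1 ≤ m) (v : ℕ) {Δ : ℝ} (hΔ : 0 < Δ) :
    ev m (n * m) (fun f => ENNReal.ofReal (2 / Δ ^ 2) * degree (graphOf m f) v) ≤
      ENNReal.ofReal (2 / Δ ^ 2 * (m + 4 * (m + 1) * √(n * m))) := by
  rw [ev_const_mul, ENNReal.ofReal_mul (by positivity)]
  refine mul_le_mul_right ?_ _
  have := ev_degree_le hm (n * m) v
  push_cast at this
  exact this

theorem samples_fst (N n : ℕ) (s l : unitInterval) (A : Set (Fin N → Bool)) :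
    samples N n s l {x | x.1 ∈ A} = choices (Fin N) s A := by
  have : {x : (Fin N → Bool) × (Fin N → Bool) × (Fin n → Bool) | x.1 ∈ A} = A ×ˢ Set.univ := by
    ext x
    simp
  rw [this, samples, Measure.prod_prod, measure_univ, mul_one]

theorem samples_snd (N n : ℕ) (s l : unitInterval) (A : Set (Fin N → Bool)) :
    samples N n s l {x | x.2.1 ∈ A} = choices (Fin N) s A := by
  have : {x : (Fin N → Bool) × (Fin N → Bool) × (Fin n → Bool) | x.2.1 ∈ A} =
      Set.univ ×ˢ (A ×ˢ Set.univ) := by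
    ext x
    simp
  rw [this, samples, Measure.prod_prod, Measure.prod_prod, measure_univ, measure_univ, mul_one,
    one_mul]

theorem measure_exists_lt_le {Ω : Type*} [MeasurableSpace Ω] (μ : Measure Ω) (U : ℕ)
    (P : ℕ → Ω → Prop) {b : ℝ} (h : ∀ v < U, μ {ω | P v ω} ≤ ENNReal.ofReal b) :
    μ {ω | ∃ v < U, P v ω} ≤ ENNReal.ofReal (U * b) := by
  have hU : {ω | ∃ v < U, P v ω} = ⋃ v ∈ range U, {ω | P v ω} := by
    ext ω
    simp
  rw [hU]
  refine (measure_biUnion_finset_le _ _).trans ?_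
  refine (Finset.sum_le_card_nsmul _ _ _ fun v hv => h v (Finset.mem_range.1 hv)).trans (le_of_eq ?_)
  rw [Finset.card_range, nsmul_eq_mul, ENNReal.ofReal_mul (by positivity), ENNReal.ofReal_natCast]

theorem law_degree_copy₁_le (hm : 1 ≤ m) (U : ℕ) {Δ : ℝ} (hΔ : 0 < Δ) :
    law m n s l {ω | ¬∀ v < n, v < U →
        |(degree (copy₁ ω) v : ℝ) - s * degree (graph ω) v| < Δ} ≤
      ENNReal.ofReal (U * (2 / Δ ^ 2 * (m + 4 * (m + 1) * √(n * m)))) := by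
  refine (measure_mono fun ω hω => ?_).trans (measure_exists_lt_le (law m n s l) U
    (fun v ω => Δ ≤ |(degree (copy₁ ω) v : ℝ) - s * degree (graph ω) v|) fun v _ => ?_)
  · simp only [Set.mem_ofPred_eq] at hω ⊢
    push Not at hω
    obtain ⟨v, -, hvU, h⟩ := hω
    exact ⟨v, hvU, h⟩
  · exact (law_le_ev fun f _ => (samples_fst _ _ s l _).trans_le
      (choices_degree_le s f v hΔ)).trans (ev_copy_le hm v hΔ)

theorem law_degree_copy₂_le (hm : 1 ≤ m) (U : ℕ) {Δ : ℝ} (hΔ : 0 < Δ) :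
    law m n s l {ω | ¬∀ v < n, v < U →
        |(degree (copy₂ ω) v : ℝ) - s * degree (graph ω) v| < Δ} ≤
      ENNReal.ofReal (U * (2 / Δ ^ 2 * (m + 4 * (m + 1) * √(n * m)))) := by
  refine (measure_mono fun ω hω => ?_).trans (measure_exists_lt_le (law m n s l) U
    (fun v ω => Δ ≤ |(degree (copy₂ ω) v : ℝ) - s * degree (graph ω) v|) fun v _ => ?_)
  · simp only [Set.mem_ofPred_eq] at hω ⊢
    push Not at hω
    obtain ⟨v, -, hvU, h⟩ := hω
    exact ⟨v, hvU, h⟩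
  · exact (law_le_ev fun f _ => (samples_snd _ _ s l _).trans_le
      (choices_degree_le s f v hΔ)).trans (ev_copy_le hm v hΔ)

/-- Both hypotheses on a node depend on the graph alone: given the graph they hold and the Chernoff
bound applies, or the bad event is empty. The degree threshold gives d·s²l ≥ 4w, and 4/436 = 1/109.
-/
theorem law_witnesses_le (hs : 0 < s) (hl : 0 < l) (w : ℝ) :
    law m n s l {ω | ¬∀ v < n, 4 * w / ((s : ℝ) ^ 2 * l) ≤ degree (graph ω) v →
        31 / 32 * (degree (graph ω) v : ℝ) ≤ (senders m n ω.1 v).card →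
        7 / 8 * (degree (graph ω) v : ℝ) * (s : ℝ) ^ 2 * l ≤
          score (copy₁ ω) (copy₂ ω) (seeds ω) v v} ≤
      ENNReal.ofReal (n * Real.exp (-w / 109)) := by
  have hs0 : (0 : ℝ) < s := hs
  have hl0 : (0 : ℝ) < l := hl
  refine (measure_mono fun ω hω => ?_).trans (measure_exists_lt_le (law m n s l) n
    (fun v ω => (4 * w / ((s : ℝ) ^ 2 * l) ≤ degree (graph ω) v ∧
        31 / 32 * (degree (graph ω) v : ℝ) ≤ (senders m n ω.1 v).card) ∧
        score (copy₁ ω) (copy₂ ω) (seeds ω) v v <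
          7 / 8 * (degree (graph ω) v : ℝ) * (s : ℝ) ^ 2 * l) fun v _ => ?_)
  · simp only [Set.mem_ofPred_eq] at hω ⊢
    push Not at hω
    obtain ⟨v, hv, h1, h2, h3⟩ := hω
    exact ⟨v, hv, ⟨h1, h2⟩, h3⟩
  · refine (law_le_ev (c := fun _ => ENNReal.ofReal (Real.exp (-w / 109))) fun f _ => ?_).trans
      (ev_const _ _ _).le
    by_cases h : 4 * w / ((s : ℝ) ^ 2 * l) ≤ degree (graphOf m f) v ∧
        31 / 32 * (degree (graphOf m f) v : ℝ) ≤ (senders m n f v).card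
    · refine (measure_mono fun x hx => hx.2).trans ((samples_score_lt_le s l f v h.2).trans
        (ENNReal.ofReal_le_ofReal (Real.exp_le_exp.2 ?_)))
      have h1 := h.1
      rw [div_le_iff₀ (by positivity), ← mul_assoc] at h1
      linarith
    · have : {x | (f, x) ∈ {ω : Outcome m n | (4 * w / ((s : ℝ) ^ 2 * l) ≤ degree (graph ω) v ∧
        31 / 32 * (degree (graph ω) v : ℝ) ≤ (senders m n ω.1 v).card) ∧
        score (copy₁ ω) (copy₂ ω) (seeds ω) v v <
          7 / 8 * (degree (graph ω) v : ℝ) * (s : ℝ) ^ 2 * l}} = ∅ := by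
        refine Set.eq_empty_of_forall_notMem fun x hx => h hx.1
      rw [this, measure_empty]
      exact zero_le

/-- The probability that the outcome is not good. -/
theorem law_not_good_le (hm : 1 ≤ m) (hs : 0 < s) (hl : 0 < l) {U : ℕ} (hU : 1 ≤ U)
    {y D Δ w : ℝ} (hy : 0 < y) (hD : 0 ≤ D) (hΔ : 0 < Δ) :
    law m n s l {ω | ¬Good s l U y D Δ (4 * w / ((s : ℝ) ^ 2 * l)) ω} ≤
      ENNReal.ofReal (4 * sharedConst m * (1 + Real.log n) ^ 4 / U) +
      ENNReal.ofReal ((U : ℝ) ^ 2 * (sharedConst m * (1 + Real.log n) ^ 4 / y)) +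
      ENNReal.ofReal (U * ((D + 1) * √(U / n))) +
      ENNReal.ofReal (U * (2 / Δ ^ 2 * (m + 4 * (m + 1) * √(n * m)))) +
      ENNReal.ofReal (U * (2 / Δ ^ 2 * (m + 4 * (m + 1) * √(n * m)))) +
      ENNReal.ofReal (U * (((Nat.log 2 (2 * (n * m)) + 1 : ℕ) * (2 * Δ / s + 1)) *
        √(U / n))) +
      ENNReal.ofReal (n * Real.exp (-w / 109)) := by
  refine le_trans (measure_mono (fun ω hω => ?_)) ((measure_union_le _ _).trans
    (add_le_add ((measure_union_le _ _).trans
    (add_le_add ((measure_union_le _ _).trans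
    (add_le_add ((measure_union_le _ _).trans
    (add_le_add ((measure_union_le _ _).trans
    (add_le_add ((measure_union_le _ _).trans
    (add_le_add ((measure_union_le _ _).trans_eq ((congrArg₂ (· + ·)
      (law_source_eq_zero (m := m) (n := n) s l) rfl).trans (zero_add _)) |>.trans
      (law_shared_late_le s l hm hU))
    (law_shared_early_le s l hm U hy)))
    (law_degree_early_le s l hm U hD)))
    (law_degree_copy₁_le s l hm U hΔ)))
    (law_degree_copy₂_le s l hm U hΔ)))
    (law_degree_pow_le s l hm hs U hΔ.le)))
    (law_witnesses_le s l hs hl w)))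
  simp only [Set.mem_union, Set.mem_ofPred_eq] at hω ⊢
  by_contra hcon
  simp only [not_or, not_not] at hcon
  obtain ⟨⟨⟨⟨⟨⟨⟨h0, h1⟩, h2⟩, h3⟩, h4⟩, h5⟩, h6⟩, h7⟩ := hcon
  exact hω ⟨h0, h1, h2, h3, h4, h5, h6, h7⟩

end Bad

end Recon

namespace Recon

/-! ### Asymptotics -/

theorem tendsto_log_natCast : Tendsto (fun n : ℕ => Real.log n) atTop atTop :=
  Real.tendsto_log_atTop.comp tendsto_natCast_atTop_atTop

theorem tendsto_root_natCast : Tendsto (fun n : ℕ => (n : ℝ) ^ (1 / 40 : ℝ)) atTop atTop :=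
  (tendsto_rpow_atTop (by norm_num)).comp tendsto_natCast_atTop_atTop

theorem root_pow (n : ℕ) : ((n : ℝ) ^ (1 / 40 : ℝ)) ^ 40 = n := by
  rw [← Real.rpow_natCast, ← Real.rpow_mul (by positivity)]
  norm_num

theorem tendsto_log_pow_div_root :
    Tendsto (fun n : ℕ => (1 + Real.log n) ^ 4 / (n : ℝ) ^ (1 / 40 : ℝ)) atTop (𝓝 0) := by
  have h1 : Tendsto (fun x : ℝ => (1 + 40 * Real.log x) ^ 4 / x) atTop (𝓝 0) := by
    have h2 : Tendsto (fun x : ℝ => 41 ^ 4 * (Real.log x ^ 4 / x)) atTop (𝓝 0) := by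
      have := (Real.isLittleO_pow_log_id_atTop (n := 4)).tendsto_div_nhds_zero
      simpa using this.const_mul (41 ^ 4)
    refine squeeze_zero' ?_ ?_ h2
    · filter_upwards [eventually_ge_atTop 0] with x hx
      positivity
    · filter_upwards [eventually_gt_atTop 0, Real.tendsto_log_atTop.eventually_ge_atTop 1]
        with x hx hl
      rw [← mul_div_assoc, ← mul_pow]
      gcongr
      linarith
  refine (h1.comp tendsto_root_natCast).congr' ?_
  filter_upwards [eventually_gt_atTop 0] with n hn
  simp only [Function.comp_apply]
  rw [Real.log_rpow (by exact_mod_cast hn)]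
  congr 3
  ring

theorem tendsto_natCast_mul_exp :
    Tendsto (fun n : ℕ => (n : ℝ) * Real.exp (-Real.log n ^ 2 / 109)) atTop (𝓝 0) := by
  have h1 : Tendsto (fun n : ℕ => Real.exp (-Real.log n)) atTop (𝓝 0) :=
    Real.tendsto_exp_neg_atTop_nhds_zero.comp tendsto_log_natCast
  refine squeeze_zero' (Eventually.of_forall fun n => by positivity) ?_ h1
  -- From log n ≥ 218 on, log² n / 109 ≥ 2 log n, which beats the factor n with 1/n to spare.
  filter_upwards [eventually_gt_atTop 0, tendsto_log_natCast.eventually_ge_atTop 218] with n hn hl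
  have hn' : (0 : ℝ) < n := by exact_mod_cast hn
  nth_rewrite 1 [← Real.exp_log hn']
  rw [← Real.exp_add]
  apply Real.exp_le_exp.2
  nlinarith

theorem natLog_add_one_le {m n : ℕ} (hm : 1 ≤ m) (hn : 1 ≤ n) :
    ((Nat.log 2 (2 * (n * m)) + 1 : ℕ) : ℝ) ≤ (4 * m + 3) * (1 + Real.log n) := by
  have hm' : (0 : ℝ) < m := by exact_mod_cast hm
  have hn' : (0 : ℝ) < n := by exact_mod_cast hn
  have h1 : (Nat.log 2 (2 * (n * m)) : ℝ) ≤ Real.logb 2 ((2 * (n * m) : ℕ) : ℝ) :=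
    Real.natLog_le_logb _ _
  have h2 : Real.logb 2 ((2 * (n * m) : ℕ) : ℝ) = (Real.log (2 * m) + Real.log n) / Real.log 2 := by
    rw [Real.logb, ← Real.log_mul (by positivity) (by positivity)]
    congr 2
    push_cast
    ring
  have h3 : Real.log (2 * m) ≤ 2 * m := (Real.log_le_sub_one_of_pos (by positivity)).trans (by linarith)
  have h4 : (1 : ℝ) / 2 ≤ Real.log 2 := by
    have := Real.log_two_gt_d9
    linarith
  have h5 : 0 ≤ Real.log n := Real.log_natCast_nonneg n
  have h6 : (Real.log (2 * m) + Real.log n) / Real.log 2 ≤ 2 * (2 * m + Real.log n) := by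
    rw [div_le_iff₀ (by linarith)]
    nlinarith
  push_cast
  nlinarith

/-- The probability of a bad outcome tends to zero. -/
theorem tendsto_law_not_good {m : ℕ} (hm : 1 ≤ m) {s l : unitInterval} (hs : 0 < s) (hl : 0 < l) :
    Tendsto (fun n : ℕ => law m n s l {ω | ¬Good s l ⌈((n : ℝ) ^ (1 / 40 : ℝ)) ^ 2⌉₊
      (((n : ℝ) ^ (1 / 40 : ℝ)) ^ 8) (((n : ℝ) ^ (1 / 40 : ℝ)) ^ 12)
      (((n : ℝ) ^ (1 / 40 : ℝ)) ^ 16) (4 * Real.log n ^ 2 / ((s : ℝ) ^ 2 * l)) ω})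
      atTop (𝓝 0) := by
  have hs0 : (0 : ℝ) < s := hs
  set C := sharedConst m
  have hC : 0 ≤ C := sharedConst_nonneg m
  have hm1 : (1 : ℝ) ≤ m := by exact_mod_cast hm
  have hg : ∀ M : ℝ, Tendsto (fun n : ℕ => ENNReal.ofReal
      (M * ((1 + Real.log n) ^ 4 / (n : ℝ) ^ (1 / 40 : ℝ)))) atTop (𝓝 0) := fun M => by
    rw [← ENNReal.ofReal_zero]
    refine ENNReal.tendsto_ofReal ?_
    simpa using tendsto_log_pow_div_root.const_mul M
  have he : Tendsto (fun n : ℕ => ENNReal.ofReal ((n : ℝ) * Real.exp (-Real.log n ^ 2 / 109)))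
      atTop (𝓝 0) := by
    rw [← ENNReal.ofReal_zero]
    exact ENNReal.tendsto_ofReal tendsto_natCast_mul_exp
  have hsum := ((((((hg (4 * C)).add (hg (4 * C))).add (hg 8)).add (hg (20 * (m + 1) ^ 2))).add
    (hg (20 * (m + 1) ^ 2))).add (hg (4 * (4 * m + 3) * (2 / s + 1)))).add he
  simp only [add_zero] at hsum
  refine tendsto_of_tendsto_of_tendsto_of_le_of_le' tendsto_const_nhds hsum
    (Eventually.of_forall fun _ => zero_le) ?_
  filter_upwards [eventually_ge_atTop 1] with n hn
  have hroot := root_pow n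
  have hn1 : (1 : ℝ) ≤ n := by exact_mod_cast hn
  have hx1 : 1 ≤ (n : ℝ) ^ (1 / 40 : ℝ) := Real.one_le_rpow hn1 (by norm_num)
  have hL0 : 0 ≤ Real.log n := Real.log_natCast_nonneg n
  have hnlog := natLog_add_one_le hm hn
  set x : ℝ := (n : ℝ) ^ (1 / 40 : ℝ)
  set L : ℝ := Real.log n
  have hx0 : 0 < x := by linarith
  have hUx : x ^ 2 ≤ (⌈x ^ 2⌉₊ : ℝ) := Nat.le_ceil _
  have hx2 : 1 ≤ x ^ 2 := one_le_pow₀ hx1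
  have hU1 : 1 ≤ ⌈x ^ 2⌉₊ := Nat.one_le_ceil_iff.2 (by positivity)
  have hU2 : (⌈x ^ 2⌉₊ : ℝ) ≤ 2 * x ^ 2 := by
    have := Nat.ceil_lt_add_one (show 0 ≤ x ^ 2 by positivity)
    linarith
  -- As √(U/n) is of order x⁻¹⁹ and √(nm) of order x²⁰, the powers of x in the terms other than the
  -- witness term are -2, -4, -5, -10, -10 and -1, up to logarithms. Each is absorbed by (1 + log
  -- n)⁴ / x.
  refine (law_not_good_le s l hm hs hl hU1 (y := x ^ 8) (D := x ^ 12) (Δ := x ^ 16) (w := L ^ 2)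
    (by positivity) (by positivity) (by positivity)).trans ?_
  set U : ℝ := (⌈x ^ 2⌉₊ : ℝ)
  have hL1 : 1 ≤ (1 + L) ^ 4 := one_le_pow₀ (by linarith)
  have hL2 : 1 + L ≤ (1 + L) ^ 4 := le_self_pow₀ (by linarith) (by norm_num)
  have hU0 : 0 ≤ U := by positivity
  have hsqrt : √(U / n) ≤ 2 / x ^ 19 := by
    rw [Real.sqrt_le_left (by positivity), ← hroot, div_pow, div_le_div_iff₀ (by positivity)
      (by positivity)]
    calc U * (x ^ 19) ^ 2 ≤ (2 * x ^ 2) * (x ^ 19) ^ 2 := by gcongr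
      _ = 2 * x ^ 40 := by ring
      _ ≤ 2 ^ 2 * x ^ 40 := by gcongr; norm_num
  have hnm : √(n * m) ≤ m * x ^ 20 := by
    rw [Real.sqrt_le_left (by positivity), ← hroot]
    calc x ^ 40 * m ≤ x ^ 40 * (m * m) := by gcongr; nlinarith
      _ = (m * x ^ 20) ^ 2 := by ring
  have hinv : ∀ k : ℕ, 1 ≤ k → ∀ M : ℝ, 0 ≤ M → M / x ^ k ≤ M / x := fun k hk M hM =>
    div_le_div_of_nonneg_left hM hx0 (le_self_pow₀ hx1 (by omega))
  have hfin : ∀ M : ℝ, 0 ≤ M → M / x ≤ M * ((1 + L) ^ 4 / x) := fun M hM => by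
    rw [← mul_div_assoc]
    gcongr
    exact le_mul_of_one_le_right hM hL1
  have t4 : U * (2 / (x ^ 16) ^ 2 * (m + 4 * (m + 1) * √(n * m))) ≤
      20 * (m + 1) ^ 2 * ((1 + L) ^ 4 / x) := by
    calc U * (2 / (x ^ 16) ^ 2 * (m + 4 * (m + 1) * √(n * m))) ≤
        (2 * x ^ 2) * (2 / (x ^ 16) ^ 2 * (m * x ^ 20 + 4 * (m + 1) * (m * x ^ 20))) := by
          gcongr
          exact le_mul_of_one_le_right (by positivity) (one_le_pow₀ hx1)
      _ = (4 * (m + 4 * (m + 1) * m)) / x ^ 10 := by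
          field_simp
          ring
      _ ≤ (20 * (m + 1) ^ 2) / x ^ 10 := by
          refine div_le_div_of_nonneg_right ?_ (by positivity)
          nlinarith
      _ ≤ _ := (hinv 10 (by norm_num) _ (by positivity)).trans (hfin _ (by positivity))
  refine add_le_add (add_le_add (add_le_add (add_le_add (add_le_add (add_le_add ?_ ?_) ?_) ?_)
    ?_) ?_) le_rfl
  · apply ENNReal.ofReal_le_ofReal
    calc 4 * C * (1 + L) ^ 4 / U ≤ 4 * C * (1 + L) ^ 4 / x ^ 2 := by gcongr
      _ ≤ 4 * C * (1 + L) ^ 4 / x := hinv 2 (by norm_num) _ (by positivity)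
      _ = _ := by ring
  · apply ENNReal.ofReal_le_ofReal
    calc U ^ 2 * (C * (1 + L) ^ 4 / x ^ 8) ≤ (2 * x ^ 2) ^ 2 * (C * (1 + L) ^ 4 / x ^ 8) := by
          gcongr
      _ = 4 * C * (1 + L) ^ 4 / x ^ 4 := by
          field_simp
          ring
      _ ≤ 4 * C * (1 + L) ^ 4 / x := hinv 4 (by norm_num) _ (by positivity)
      _ = _ := by ring
  · apply ENNReal.ofReal_le_ofReal
    calc U * ((x ^ 12 + 1) * √(U / n)) ≤ (2 * x ^ 2) * ((x ^ 12 + x ^ 12) * (2 / x ^ 19)) := by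
          gcongr
          exact one_le_pow₀ hx1
      _ = 8 / x ^ 5 := by
          field_simp
          ring
      _ ≤ _ := (hinv 5 (by norm_num) _ (by positivity)).trans (hfin _ (by positivity))
  · exact ENNReal.ofReal_le_ofReal t4
  · exact ENNReal.ofReal_le_ofReal t4
  · apply ENNReal.ofReal_le_ofReal
    calc U * (((Nat.log 2 (2 * (n * m)) + 1 : ℕ) * (2 * x ^ 16 / s + 1)) * √(U / n)) ≤
        (2 * x ^ 2) * ((((4 * (m : ℝ) + 3) * (1 + L) ^ 4) * (2 * x ^ 16 / (s : ℝ) + x ^ 16)) *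
          (2 / x ^ 19)) := by
          gcongr
          · exact hnlog.trans (by gcongr)
          · exact one_le_pow₀ hx1
      _ = 4 * (4 * (m : ℝ) + 3) * (2 / (s : ℝ) + 1) * ((1 + L) ^ 4 / x) := by
          field_simp
          ring

end Recon

theorem mainTheorem2 (m : ℕ) (hm : 1 ≤ m) (s l : unitInterval) (hs : 0 < s) (hl : 0 < l)
    (T k : ℕ) (hT : 9 ≤ T) (hk : 1 ≤ k) :
    Tendsto
      (fun n : ℕ => Recon.law m n s l
        {ω | ∀ v < n,
          4 * Real.log n ^ 2 / ((s : ℝ) ^ 2 * l) ≤ (Recon.degree (Recon.graph ω) v : ℝ) →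
            -- `v` has many first-phase similarity witnesses with its true copy
            (7 / 8 * (Recon.degree (Recon.graph ω) v : ℝ) * (s : ℝ) ^ 2 * l ≤
              (Recon.score (Recon.copy₁ ω) (Recon.copy₂ ω) (Recon.seeds ω) v v : ℝ)) ∧
            -- and fewer with the copy of any other node
            (∀ u < n, u ≠ v →
              (Recon.score (Recon.copy₁ ω) (Recon.copy₂ ω) (Recon.seeds ω) v u : ℝ) <
                7 / 8 * (Recon.degree (Recon.graph ω) v : ℝ) * (s : ℝ) ^ 2 * l ∧
              (Recon.score (Recon.copy₁ ω) (Recon.copy₂ ω) (Recon.seeds ω) u v : ℝ) <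
                7 / 8 * (Recon.degree (Recon.graph ω) v : ℝ) * (s : ℝ) ^ 2 * l) ∧
            -- and the algorithm links its two copies, and links neither of them to another node
            (v, v) ∈ Recon.userMatching n (Recon.copy₁ ω) (Recon.copy₂ ω) (Recon.seeds ω) T k ∧
            ∀ u < n, u ≠ v →
              (v, u) ∉ Recon.userMatching n (Recon.copy₁ ω) (Recon.copy₂ ω) (Recon.seeds ω) T k ∧
              (u, v) ∉ Recon.userMatching n (Recon.copy₁ ω) (Recon.copy₂ ω) (Recon.seeds ω) T k})
      atTop (𝓝 1) := by
  have hs0 : (0 : ℝ) < s := hs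
  have hl0 : (0 : ℝ) < l := hl
  have hp0 : 0 < (s : ℝ) ^ 2 * l := by positivity
  have hm1 : (1 : ℝ) ≤ m := by exact_mod_cast hm
  have hbad := Recon.tendsto_law_not_good hm hs hl
  have hlow := ENNReal.Tendsto.sub (tendsto_const_nhds (x := (1 : ENNReal)) (f := atTop)) hbad
    (Or.inl ENNReal.one_ne_top)
  rw [tsub_zero] at hlow
  refine tendsto_of_tendsto_of_tendsto_of_le_of_le' hlow tendsto_const_nhds ?_
    (Eventually.of_forall fun n => prob_le_one)
  -- The bound 40m + T serves `hmw` and `hTw`. The bound 192m serves `hyD`, as 160m + 32m·x⁸ ≤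
  -- 192m·x⁸. The bound 7/(s²l) serves `hyD'`, as 49/8·x⁸ > x⁸ + 5. The last condition gives log² n
  -- ≤ x, for `hwD`.
  filter_upwards [eventually_ge_atTop 1,
    Recon.tendsto_log_natCast.eventually_ge_atTop (40 * m + T),
    Recon.tendsto_root_natCast.eventually_ge_atTop (192 * m),
    Recon.tendsto_root_natCast.eventually_ge_atTop (7 / ((s : ℝ) ^ 2 * l)),
    Recon.tendsto_log_pow_div_root.eventually_le_const zero_lt_one] with n hn hLn hx1 hx2 hgn
  set x : ℝ := (n : ℝ) ^ (1 / 40 : ℝ)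
  set L : ℝ := Real.log n
  have hT0 : (0 : ℝ) ≤ T := by positivity
  have hxone : 1 ≤ x := by linarith
  have hx0 : 0 < x := by linarith
  have hL1 : 1 ≤ L := by linarith
  have hLL : L ≤ L ^ 2 := by nlinarith
  rw [div_le_one hx0] at hgn
  rw [div_le_iff₀ hp0] at hx2
  have hLx : L ^ 2 ≤ x := by
    refine le_trans ?_ hgn
    calc L ^ 2 ≤ (1 + L) ^ 2 := by gcongr; linarith
      _ ≤ (1 + L) ^ 4 := pow_le_pow_right₀ (by linarith) (by norm_num)
  have hx4 : x ≤ x ^ 4 := le_self_pow₀ hxone (by norm_num)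
  have hx8 : 1 ≤ x ^ 8 := one_le_pow₀ hxone
  have hx12 : x ^ 12 = x ^ 4 * x ^ 8 := by ring
  have hstep : ∀ c : ℝ, c ≤ x → c * x ^ 8 ≤ x ^ 12 := fun c hc => by
    rw [hx12]
    exact mul_le_mul_of_nonneg_right (hc.trans hx4) (by positivity)
  have h1 := hstep _ hx1
  have h2 : 7 * x ^ 8 ≤ x ^ 12 * ((s : ℝ) ^ 2 * l) := by
    have := hstep (7 / ((s : ℝ) ^ 2 * l)) ((div_le_iff₀ hp0).2 hx2)
    rwa [div_mul_eq_mul_div, div_le_iff₀ hp0] at this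
  have h3 : x * x ≤ x ^ 12 := by
    rw [← sq]
    exact pow_le_pow_right₀ hxone (by norm_num)
  refine (tsub_le_iff_right.2 ?_ : (1 : ENNReal) - _ ≤ _)
  have hcover := measure_union_le (μ := Recon.law m n s l)
    {ω | Recon.Good s l ⌈x ^ 2⌉₊ (x ^ 8) (x ^ 12) (x ^ 16) (4 * L ^ 2 / ((s : ℝ) ^ 2 * l)) ω}
    {ω | ¬Recon.Good s l ⌈x ^ 2⌉₊ (x ^ 8) (x ^ 12) (x ^ 16) (4 * L ^ 2 / ((s : ℝ) ^ 2 * l)) ω}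
  rw [show {ω | Recon.Good (m := m) (n := n) s l ⌈x ^ 2⌉₊ (x ^ 8) (x ^ 12) (x ^ 16)
      (4 * L ^ 2 / ((s : ℝ) ^ 2 * l)) ω} ∪ {ω | ¬Recon.Good s l ⌈x ^ 2⌉₊ (x ^ 8) (x ^ 12) (x ^ 16)
      (4 * L ^ 2 / ((s : ℝ) ^ 2 * l)) ω} = Set.univ from Set.eq_univ_of_forall fun ω => em _,
    measure_univ] at hcover
  refine hcover.trans (add_le_add_left (measure_mono fun ω hω v hv hdv => ?_) _)
  refine Recon.Good.conclusion hm hs hl hT hk hω (by linarith) (by linarith) ?_ ?_ ?_ v hv hdv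
  · have : (m : ℝ) ≤ m * x ^ 8 := le_mul_of_one_le_right (by linarith) hx8
    linarith
  · have : 7 / 8 * x ^ 12 * (s : ℝ) ^ 2 * l = 7 / 8 * (x ^ 12 * ((s : ℝ) ^ 2 * l)) := by ring
    rw [this]
    nlinarith
  · rw [div_le_iff₀ hp0]
    nlinarith
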